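/- **Setting.** All homology is simplicial (unreduced) with coefficients in $\mathbb Z_2$; a chain is identified with the set of its simplices. Let $\mathcal F:\ \emptyset=K_0\leftrightarrow K_1\leftrightarrow\cdots\leftrightarrow K_m=\emptyset$ be a simplex-wise zigzag filtration: the $k$-th arrow $K_k\leftrightarrow K_{k+1}$ is a forward inclusion $K_k\hookrightarrow K_{k+1}$ adding one simplex $\sigma_k$ or a backward inclusion $K_k\hookleftarrow K_{k+1}$ deleting one simplex $\sigma_k$. $\mathsf{Pers}_q(\mathcal F)$ is the multiset of intervals in an interval decomposition of the zigzag module $H_q(\mathcal F)$. A *$q$-th representative* for $[b,d]\subseteq\{1,\dots,m-1\}$ consists of $q$-cycles $z_k$ in $K_k$ ($b\le k\le d$) and $(q+1)$-chains $c_k$ such that for $b\le k<d$ the chain $c_k$ lies in the larger of $K_k,K_{k+1}$ and $z_k+z_{k+1}=\partial c_k$; if arrow $b-1$ is forward, $\sigma_{b-1}\in z_b$ ($c_{b-1}$ is undefined), and if it is backward, $z_b=\partial c_{b-1}$ with $c_{b-1}\ni\sigma_{b-1}$ a chain in $K_{b-1}$; if arrow $d$ is backward, $\sigma_d\in z_d$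 ($c_d$ is undefined), and if it is forward, $z_d=\partial c_d$ with $c_d\ni\sigma_d$ a chain in $K_{d+1}$. The sum $\zeta\oplus\zeta'$ of two representatives adds, at each index and each arrow, the cycles and chains that are defined. Write $b_1\prec_{\mathsf b}b_2$ if $b_1<b_2$ and arrow $b_2-1$ is forward, or $b_1>b_2$ and arrow $b_1-1$ is backward; $d_1\prec_{\mathsf d}d_2$ if $d_1>d_2$ and arrow $d_2$ is backward, or $d_1<d_2$ and arrow $d_1$ is forward; and $[b_1,d_1]\prec[b_2,d_2]$ if $b_1\prec_{\mathsf b}b_2$ and $d_1\prec_{\mathsf d}d_2$ (two intervals are comparable if one of them is $\prec$ the other). **Operation.** Let $0\le i\le m$ and let $\sigma\in K_i$ be a $p$-simplex without proper cofaces in $K_i$. Let $\mathcal F'$ be $$K_0\leftrightarrow\cdots\leftrightarrow K_i\hookleftarrow K_i\setminus\{\sigma\}\hookrightarrow K_i\leftrightarrow K_{i+1}\leftrightarrow\cdots\leftrightarrow K_m,$$ reindexed by $0,\dots,m'$, $m'=m+2$, so that the old index $i$ becomes the three indices $i,i+1,i+2$. For an interval $[b,d]$ of $\mathcal F$ let $b^+=b$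 if $b\le i$ and $b^+=b+2$ otherwise; $d^+=d$ if $d<i$ and $d^+=d+2$ otherwise. A representative of $\mathcal F$ is *expanded* to $\mathcal F'$ by repeating its cycle at $i$ three times, with zero chains at the two new arrows. Let $n$ be the number of simplices in the union of all complexes. Let the barcode of $\mathcal F$ in all dimensions be given together with a representative for each interval, and let $\Lambda_0$ be the set of the $p$-dimensional intervals containing $i$ whose cycle at $i$ contains $\sigma$. Let $\iota:H_*(K_i\setminus\{\sigma\})\to H_*(K_i)$ be induced by inclusion. **Theorem.** $\iota$ is surjective iff $\Lambda_0=\emptyset$, and injective iff $\Lambda_0\ne\emptyset$. 1. If $\iota$ is surjective, then $p\ge1$, and the barcode of $\mathcal F'$ consists of the intervals $[b^+,d^+]$ for all intervals $[b,d]$ of $\mathcal F$, with expanded representatives, and of one more interval $[i+1,i+1]$ in dimension $p-1$, with the representative $z_{i+1}=\partial\sigma$, $c_i=c_{i+1}=\sigma$. 2. If $\iota$ is injective, start with $\Lambda=\Lambda_0$ and, as long as there are $I,J\in\Lambda$ with $I\prec J$, choose such a pair, replace the representative of $J$ by the sum of those of $I$ and $J$, and delete $J$ from $\Lambda$. This procedure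 can be carried out until no such pair is left, and whenever this has been done, whatever the choices, the intervals left in $\Lambda$ are pairwise incomparable and can be listed as $[b_1,d_1],\dots,[b_\ell,d_\ell]$ with $\ell\ge1$ and $b_1\prec_{\mathsf b}\cdots\prec_{\mathsf b}b_\ell$; then $d_\ell\prec_{\mathsf d}\cdots\prec_{\mathsf d}d_1$. The barcode of $\mathcal F'$ consists of: the intervals $[b^+,d^+]$ for all intervals $[b,d]$ of $\mathcal F$ not left in $\Lambda$, with their (possibly replaced) representatives expanded; and, in dimension $p$, the intervals $[b_{j+1},d_j+2]$ for $1\le j<\ell$, with the expanded sums of the representatives of $[b_j,d_j]$ and $[b_{j+1},d_{j+1}]$; the interval $[b_1,i]$, with the prefix up to $i$ of the representative of $[b_1,d_1]$; and the interval $[i+2,d_\ell+2]$, with the suffix from $i$ on of the representative of $[b_\ell,d_\ell]$ (moved to the new indices). In both cases all the sequences named are valid representatives in $\mathcal F'$, and the update takes $O(m'n^2)$ elementary steps with an absolute constant. Here an elementary step is a test or comparison of indices, dimensions or intervals, the setting of one pointer to a cycle or chain of a representative, or the handling of one simplex when a chain is searched or two chains are added (so each of these costs $n$ steps); each search for a pair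 $I\prec J$ in $\Lambda$ costs $|\Lambda|^2$ steps, and sorting the final $\Lambda$ costs $\ell^2$ steps. -/

import Mathlib

universe u v w

noncomputable section

open scoped Classical DirectSum

namespace Zigzag

/-! ### Simplicial homology over `ℤ/2` -/

/-- Finite simplicial complexes are sets of nonempty finite vertex sets closed under passing to
nonempty subsets; the empty complex is `⊥`. -/
abbrev Cplx (V : Type u) := PreAbstractSimplicialComplex V

/-- Chains with coefficients in `ℤ/2`; the set of simplices of a chain is its `support`. -/
abbrev Chain (V : Type u) := Finset V →₀ ZMod 2

variable {V : Type u}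

/-- The (unreduced) boundary: a simplex with at least two vertices is sent to the sum of its
facets, a vertex is sent to `0`. -/
def boundary : Chain V →ₗ[ZMod 2] Chain V :=
  Finsupp.linearCombination (ZMod 2) fun s : Finset V =>
    if s.card ≤ 1 then 0 else ∑ x ∈ s, Finsupp.single (s.erase x) 1

/-- `C_p(K)`: chains of `p`-simplices (with `p + 1` vertices) of `K`. -/
def chains (K : Cplx V) (p : ℕ) : Submodule (ZMod 2) (Chain V) :=
  Finsupp.supported (ZMod 2) (ZMod 2) {s | s ∈ K ∧ s.card = p + 1}

/-- `Z_p(K)`. -/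
def cycles (K : Cplx V) (p : ℕ) : Submodule (ZMod 2) (Chain V) :=
  chains K p ⊓ LinearMap.ker boundary

/-- `B_p(K)`. -/
def boundaries (K : Cplx V) (p : ℕ) : Submodule (ZMod 2) (Chain V) :=
  (chains K (p + 1)).map boundary

/-- `H_p(K) = Z_p(K) / B_p(K)`. -/
def Homology (K : Cplx V) (p : ℕ) : Type u :=
  cycles K p ⧸ ((boundaries K p).comap (cycles K p).subtype : Submodule (ZMod 2) (cycles K p))

instance (K : Cplx V) (p : ℕ) : AddCommGroup (Homology K p) :=
  Submodule.Quotient.addCommGroup _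

instance (K : Cplx V) (p : ℕ) : Module (ZMod 2) (Homology K p) :=
  Submodule.Quotient.module _

theorem chains_mono {K L : Cplx V} (h : K ≤ L) (p : ℕ) : chains K p ≤ chains L p :=
  Finsupp.supported_mono fun _ hs => ⟨h hs.1, hs.2⟩

theorem cycles_mono {K L : Cplx V} (h : K ≤ L) (p : ℕ) : cycles K p ≤ cycles L p :=
  inf_le_inf_right _ (chains_mono h p)

/-- The map `H_p(K) → H_p(L)` induced by an inclusion `K ⊆ L`. -/
def homologyMap {K L : Cplx V} (h : K ≤ L) (p : ℕ) :
    Homology K p →ₗ[ZMod 2] Homology L p :=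
  Submodule.mapQ _ _ (Submodule.inclusion (cycles_mono h p)) fun _ hx =>
    Submodule.map_mono (chains_mono h (p + 1)) hx

/-! ### Zigzag modules and their interval decompositions -/

/-- A zigzag module `M_0 ↔ M_1 ↔ ⋯ ↔ M_m`, the `k`-th arrow pointing forward iff `fwd k`.
Only the spaces with index at most `m` matter. -/
structure ZigzagModule (m : ℕ) (fwd : ℕ → Prop) where
  space : ℕ → Type v
  [grp : ∀ k, AddCommGroup (space k)]
  [mod : ∀ k, Module (ZMod 2) (space k)]
  right : ∀ k, k < m → fwd k → (space k →ₗ[ZMod 2] space (k + 1))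
  left : ∀ k, k < m → ¬ fwd k → (space (k + 1) →ₗ[ZMod 2] space k)

attribute [instance] ZigzagModule.grp ZigzagModule.mod

namespace ZigzagModule

variable {m : ℕ} {fwd : ℕ → Prop}

/-- The map between two spaces of an interval module: it is the identity of `ℤ/2` where both
spaces are `ℤ/2`, and zero otherwise. -/
def intervalMap (P Q : Prop) : (PLift P → ZMod 2) →ₗ[ZMod 2] (PLift Q → ZMod 2) where
  toFun f := fun _ => if h : P then f ⟨h⟩ else 0
  map_add' f g := by funext q; by_cases h : P <;> simp [h]
  map_smul' a f := by funext q; by_cases h : P <;> simp [h]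

/-- The interval module over `[b, d]`: its `k`-th space is `ℤ/2` (functions on a one-point type)
if `b ≤ k ≤ d`, and `0` (functions on the empty type) otherwise. -/
def interval (m : ℕ) (fwd : ℕ → Prop) (b d : ℕ) : ZigzagModule.{0} m fwd where
  space k := PLift (b ≤ k ∧ k ≤ d) → ZMod 2
  right _ _ _ := intervalMap _ _
  left _ _ _ := intervalMap _ _

/-- Direct sums of zigzag modules. -/
def directSum {ι : Type} (M : ι → ZigzagModule.{0} m fwd) : ZigzagModule.{0} m fwd where
  space k := ⨁ j, (M j).space k
  right k hk h := DirectSum.lmap fun j => (M j).right k hk h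
  left k hk h := DirectSum.lmap fun j => (M j).left k hk h

/-- Isomorphisms of zigzag modules. -/
structure Iso (M : ZigzagModule.{v} m fwd) (N : ZigzagModule.{w} m fwd) where
  equiv : ∀ k, k ≤ m → (M.space k ≃ₗ[ZMod 2] N.space k)
  right_comm : ∀ k (hk : k < m) (h : fwd k) (x : M.space k),
    equiv (k + 1) hk (M.right k hk h x) = N.right k hk h (equiv k hk.le x)
  left_comm : ∀ k (hk : k < m) (h : ¬ fwd k) (x : M.space (k + 1)),
    equiv k hk.le (M.left k hk h x) = N.left k hk h (equiv (k + 1) hk x)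

/-- The multiset `B` of intervals `[b, d] ⊆ {0, …, m}` (as pairs `(b, d)`) is the barcode of `M`:
`M` is isomorphic to the direct sum of the interval modules over the members of `B`. -/
def IsBarcode (M : ZigzagModule.{v} m fwd) (B : Multiset (ℕ × ℕ)) : Prop :=
  (∀ I ∈ B, I.1 ≤ I.2 ∧ I.2 ≤ m) ∧
    Nonempty (Iso M (directSum fun j : B => interval m fwd j.1.1 j.1.2))

end ZigzagModule

/-! ### Simplex-wise zigzag filtrations -/

/-- `L` is obtained from `K` by adding the simplex `s`. -/
def IsAddition (K : Cplx V) (s : Finset V) (L : Cplx V) : Prop :=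
  s ∉ K ∧ L.faces = insert s K.faces

/-- A simplex-wise zigzag filtration `∅ = K_0 ↔ K_1 ↔ ⋯ ↔ K_len = ∅`; the `k`-th arrow adds or
deletes the simplex `sx k`. Only `cx k` for `k ≤ len` and `sx k` for `k < len` matter. -/
structure Filtration (V : Type u) where
  len : ℕ
  cx : ℕ → Cplx V
  sx : ℕ → Finset V
  cx_zero : cx 0 = ⊥
  cx_len : cx len = ⊥
  step : ∀ k, k < len →
    IsAddition (cx k) (sx k) (cx (k + 1)) ∨ IsAddition (cx (k + 1)) (sx k) (cx k)

/-- Removal of a simplex without proper cofaces. -/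
def removeSimplex (K : Cplx V) (s : Finset V) (h : ∀ t ∈ K, s ⊆ t → t = s) : Cplx V where
  faces := K.faces \ {s}
  isRelLowerSet_faces := by
    rintro a ⟨ha, has⟩
    refine ⟨(K.isRelLowerSet_faces ha).1, fun b hb hne => ?_⟩
    refine ⟨(K.isRelLowerSet_faces ha).2 hb hne, ?_⟩
    rintro rfl
    exact has (h a ha hb)

theorem removeSimplex_le (K : Cplx V) (s : Finset V) (h : ∀ t ∈ K, s ⊆ t → t = s) :
    removeSimplex K s h ≤ K :=
  fun _ ht => ht.1

theorem isAddition_removeSimplex (K : Cplx V) (s : Finset V) (h : ∀ t ∈ K, s ⊆ t → t = s)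
    (hs : s ∈ K) : IsAddition (removeSimplex K s h) s K :=
  ⟨fun hm => hm.2 rfl, (Set.insert_sdiff_self_of_mem hs).symm⟩

namespace Filtration

/-- The `k`-th arrow is a forward inclusion. -/
def fwd (F : Filtration V) (k : ℕ) : Prop := F.cx k ≤ F.cx (k + 1)

theorem le_of_not_fwd (F : Filtration V) {k : ℕ} (hk : k < F.len) (h : ¬ F.fwd k) :
    F.cx (k + 1) ≤ F.cx k := by
  rcases F.step k hk with h' | h'
  · exact absurd (fun s hs => h'.2 ▸ Set.mem_insert_of_mem _ hs) h
  · exact fun s hs => h'.2 ▸ Set.mem_insert_of_mem _ hs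

/-- The zigzag module `H_p(F)`. -/
def homology (F : Filtration V) (p : ℕ) : ZigzagModule.{u} F.len F.fwd where
  space k := Homology (F.cx k) p
  right _ _ h := homologyMap h p
  left _ hk h := homologyMap (F.le_of_not_fwd hk h) p

/-- The number of simplices in the union of all complexes of the filtration. -/
def numSimplices (F : Filtration V) : ℕ := {s | ∃ k ≤ F.len, s ∈ F.cx k}.ncard

/-- The outward expansion
`K_0 ↔ ⋯ ↔ K_{i-1} ↔ K_i ↩ K_i \ {s} ↪ K_i ↔ K_{i+1} ↔ ⋯ ↔ K_len`. -/
def expand (F : Filtration V) (i : ℕ) (hi : i ≤ F.len) (s : Finset V) (hs : s ∈ F.cx i)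
    (hc : ∀ t ∈ F.cx i, s ⊆ t → t = s) : Filtration V where
  len := F.len + 2
  cx k := if k ≤ i then F.cx k else if k = i + 1 then removeSimplex (F.cx i) s hc
    else F.cx (k - 2)
  sx k := if k < i then F.sx k else if k ≤ i + 1 then s else F.sx (k - 2)
  cx_zero := by simp [F.cx_zero]
  cx_len := by
    rw [if_neg (by omega), if_neg (by omega)]
    exact F.cx_len
  step k hk := by
    have key := isAddition_removeSimplex (F.cx i) s hc hs
    rcases lt_trichotomy k i with h | h | h
    · rw [if_pos h.le, if_pos (show k + 1 ≤ i from h), if_pos h]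
      exact F.step k (by omega)
    · subst h
      right
      simpa using key
    · rcases Nat.eq_or_lt_of_le (show i + 1 ≤ k from h) with h' | h'
      · subst h'
        left
        simpa using key
      · obtain ⟨j, rfl⟩ : ∃ j, k = j + 2 := ⟨k - 2, by omega⟩
        have e1 : j + 2 + 1 - 2 = j + 1 := by omega
        rw [if_neg (by omega), if_neg (by omega), if_neg (by omega), if_neg (by omega),
          if_neg (by omega), if_neg (by omega), e1]
        exact F.step j (by omega)

/-- The order `≺_b` on birth indices. -/
def precB (F : Filtration V) (b₁ b₂ : ℕ) : Prop :=
  (b₁ < b₂ ∧ F.fwd (b₂ - 1)) ∨ (b₂ < b₁ ∧ ¬ F.fwd (b₁ - 1))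

/-- The order `≺_d` on death indices. -/
def precD (F : Filtration V) (d₁ d₂ : ℕ) : Prop :=
  (d₂ < d₁ ∧ ¬ F.fwd d₂) ∨ (d₁ < d₂ ∧ F.fwd d₁)

end Filtration

/-! ### Representative sequences -/

/-- An interval `[birth, death]` in dimension `dim` together with the data of a sequence of cycles
`z k` and of chains `c k`, the chain `c k` being attached to the `k`-th arrow. Only `z k` for
`birth ≤ k ≤ death` and those `c k` that are defined (see `HasChain`) matter. -/
structure Bar (V : Type u) where
  dim : ℕ
  birth : ℕ
  death : ℕ
  z : ℕ → Chain V
  c : ℕ → Chain V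

namespace Bar

/-- The interval contains the index `i`. -/
def Contains (x : Bar V) (i : ℕ) : Prop := x.birth ≤ i ∧ i ≤ x.death

/-- The sequence of `x` is a `dim`-th representative sequence for `[birth, death]` in `F`. -/
structure IsRep (F : Filtration V) (x : Bar V) : Prop where
  one_le_birth : 1 ≤ x.birth
  birth_le_death : x.birth ≤ x.death
  death_lt_len : x.death < F.len
  cycle : ∀ k, x.Contains k → x.z k ∈ cycles (F.cx k) x.dim
  chain : ∀ k, x.birth ≤ k → k < x.death →
    x.c k ∈ chains (if F.fwd k then F.cx (k + 1) else F.cx k) (x.dim + 1) ∧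
      x.z k + x.z (k + 1) = boundary (x.c k)
  birth_forward : F.fwd (x.birth - 1) → F.sx (x.birth - 1) ∈ (x.z x.birth).support
  birth_backward : ¬ F.fwd (x.birth - 1) →
    x.c (x.birth - 1) ∈ chains (F.cx (x.birth - 1)) (x.dim + 1) ∧
      F.sx (x.birth - 1) ∈ (x.c (x.birth - 1)).support ∧
      x.z x.birth = boundary (x.c (x.birth - 1))
  death_forward : F.fwd x.death →
    x.c x.death ∈ chains (F.cx (x.death + 1)) (x.dim + 1) ∧
      F.sx x.death ∈ (x.c x.death).support ∧
      x.z x.death = boundary (x.c x.death)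
  death_backward : ¬ F.fwd x.death → F.sx x.death ∈ (x.z x.death).support

/-- The chain at the `k`-th arrow is a defined term of the sequence. -/
def HasChain (F : Filtration V) (x : Bar V) (k : ℕ) : Prop :=
  (x.birth ≤ k ∧ k < x.death) ∨ (k + 1 = x.birth ∧ ¬ F.fwd k) ∨ (k = x.death ∧ F.fwd k)

/-- The cycles of the sum of two representative sequences: at each index, the sum of those of the
two cycles that are present. -/
def sumZ (x y : Bar V) (k : ℕ) : Chain V :=
  (if x.Contains k then x.z k else 0) + (if y.Contains k then y.z k else 0)

/-- The chains of the sum of two representative sequences: at each arrow, the sum of those of the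
two chains that are defined. -/
def sumC (F : Filtration V) (x y : Bar V) (k : ℕ) : Chain V :=
  (if x.HasChain F k then x.c k else 0) + (if y.HasChain F k then y.c k else 0)

/-- `[b₁, d₁] ≺ [b₂, d₂]`. -/
def Prec (F : Filtration V) (x y : Bar V) : Prop :=
  F.precB x.birth y.birth ∧ F.precD x.death y.death

/-- The interval of `y`, with the sum of the sequences of `x` and `y`. -/
def addTo (F : Filtration V) (x y : Bar V) : Bar V :=
  { y with z := sumZ x y, c := sumC F x y }

/-! In the expanded filtration, the index `i` becomes the three indices `i, i + 1, i + 2`, and the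
two new arrows are the ones with index `i` and `i + 1`. -/

/-- The cycle at `i` is repeated three times. -/
def expandZ (i : ℕ) (z : ℕ → Chain V) (k : ℕ) : Chain V :=
  if k ≤ i then z k else if k = i + 1 then z i else z (k - 2)

/-- The chains at the two new arrows are `0`. -/
def expandC (i : ℕ) (c : ℕ → Chain V) (k : ℕ) : Chain V :=
  if k < i then c k else if k ≤ i + 1 then 0 else c (k - 2)

/-- The interval and the sequence of `x`, carried over to the expanded filtration. -/
def carry (i : ℕ) (x : Bar V) : Bar V where
  dim := x.dim
  birth := if x.birth ≤ i then x.birth else x.birth + 2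
  death := if x.death < i then x.death else x.death + 2
  z := expandZ i x.z
  c := expandC i x.c

/-- The interval from the birth of `y` to the death of `x` with the sum of the two sequences,
carried over to the expanded filtration. -/
def link (F : Filtration V) (i : ℕ) (x y : Bar V) : Bar V :=
  carry i ⟨x.dim, y.birth, x.death, sumZ x y, sumC F x y⟩

/-- The prefix of `x` up to `i`, ending at the first of the three copies of `i`. -/
def prefixBar (i : ℕ) (x : Bar V) : Bar V where
  dim := x.dim
  birth := x.birth
  death := i
  z := expandZ i x.z
  c := expandC i x.c

/-- The suffix of `x` from `i` on, starting at the last of the three copies of `i`. -/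
def suffixBar (i : ℕ) (x : Bar V) : Bar V where
  dim := x.dim
  birth := i + 2
  death := x.death + 2
  z := expandZ i x.z
  c := expandC i x.c

/-- The interval `[i + 1, i + 1]` in dimension `p - 1`, represented by the boundary of the
`p`-simplex `s`, with both chains equal to `s`. -/
def newBar (i p : ℕ) (s : Finset V) : Bar V where
  dim := p - 1
  birth := i + 1
  death := i + 1
  z _ := boundary (Finsupp.single s 1)
  c _ := Finsupp.single s 1

/-- The cycle at index `i` of a `p`-dimensional interval through `i` contains `s`. -/
def Touched (i p : ℕ) (s : Finset V) (x : Bar V) : Prop :=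
  x.dim = p ∧ x.Contains i ∧ s ∈ (x.z i).support

end Bar

/-- The members of `D` that are `Touched`. -/
def touched (i p : ℕ) (s : Finset V) (D : Multiset (Bar V)) : Multiset (Bar V) :=
  D.filter fun x => x.Touched i p s

/-- The members of `D` that are not `Touched`. -/
def untouched (i p : ℕ) (s : Finset V) (D : Multiset (Bar V)) : Multiset (Bar V) :=
  D.filter fun x => ¬ x.Touched i p s

/-- `D` is the barcode of `F` in all dimensions, each interval being equipped with a
representative sequence. -/
def IsRepBarcode (F : Filtration V) (D : Multiset (Bar V)) : Prop :=
  (∀ x ∈ D, x.IsRep F) ∧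
    ∀ q, (F.homology q).IsBarcode
      ((D.filter fun x => x.dim = q).map fun x => (x.birth, x.death))

/-! ### The update algorithm and its step count

Elementary steps are: comparing or testing an index, a dimension or a pair of intervals; setting
one pointer to a cycle or to a chain; and handling one simplex of the total complex when scanning
or adding chains. Below, `n` is the number of simplices of the total complex, so that adding two
chains and looking a simplex up in a chain both take `n` steps. -/

/-- Number of (pointers to) cycles and chains in a sequence for `[b, d]`: the indices
`b, …, d` and the arrows `b - 1, …, d`. -/
def seqSize (b d : ℕ) : ℕ := (d + 1 - b) + (d + 2 - b)

/-- Steps for computing a sum of two representative sequences for the interval `[b, d]`. -/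
def sumTime (n b d : ℕ) : ℕ := n * seqSize b d

/-- Steps for testing which intervals of `D` have a cycle at `i` that contains the `p`-simplex. -/
def scanTime (n i p : ℕ) (D : Multiset (Bar V)) : ℕ :=
  (D.map fun x => 1 + if x.dim = p ∧ x.Contains i then n else 0).sum

/-- Steps for carrying an interval over: the sequence has to be rewritten if the interval
contains `i`, and is kept otherwise. -/
def carryTime (i : ℕ) (x : Bar V) : ℕ :=
  1 + if x.Contains i then seqSize (Bar.carry i x).birth (Bar.carry i x).death else 0

/-- `Reduces F n U Λ t U' Λ'`: starting from `(U, Λ)`, and as long as there are members `x ≺ y`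
of `Λ`, such a pair is chosen, the sequence of `x` is added to that of `y`, and `y` is moved
from `Λ` to `U`; a run of this procedure takes `t` steps and ends in `(U', Λ')`.
Each search for a comparable pair is charged `|Λ|²` steps. -/
inductive Reduces (F : Filtration V) (n : ℕ) : Multiset (Bar V) → Multiset (Bar V) → ℕ →
    Multiset (Bar V) → Multiset (Bar V) → Prop
  | done (U Λ : Multiset (Bar V)) (h : ∀ x ∈ Λ, ∀ y ∈ Λ, ¬ Bar.Prec F x y) :
      Reduces F n U Λ (Λ.card ^ 2) U Λ
  | step (U Λ : Multiset (Bar V)) (x y : Bar V) (h : Bar.Prec F x y) (t : ℕ)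
      (U' Λ' : Multiset (Bar V))
      (hr : Reduces F n (Bar.addTo F x y ::ₘ U) (x ::ₘ Λ) t U' Λ') :
      Reduces F n U (x ::ₘ y ::ₘ Λ)
        ((Λ.card + 2) ^ 2 + sumTime n y.birth y.death + t) U' Λ'

/-- The result of the update if the map is surjective. -/
def surjOutput (i p : ℕ) (s : Finset V) (D : Multiset (Bar V)) : Multiset (Bar V) :=
  Bar.newBar i p s ::ₘ D.map (Bar.carry i)

/-- The number of steps of the update if the map is surjective; the last summand is for setting up
the new interval. -/
def surjTime (n i p : ℕ) (D : Multiset (Bar V)) : ℕ :=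
  scanTime n i p D + (D.map (carryTime i)).sum + (n + 3)

/-- The result of the update if the map is injective: `U` are the intervals that are kept, and
`L = [x_1, …, x_ℓ]` the remaining ones in the order `≺_b`. These are replaced by the intervals from
the birth of `x_{j+1}` to the death of `x_j` and by the prefix of `x_1` and the suffix of `x_ℓ`. -/
def injOutput (F : Filtration V) (i : ℕ) (U : Multiset (Bar V)) (L : List (Bar V)) :
    Multiset (Bar V) :=
  U.map (Bar.carry i) + (List.zipWith (Bar.link F i) L L.tail : Multiset (Bar V)) +
    ((L.head?.toList.map (Bar.prefixBar i) : List (Bar V)) : Multiset (Bar V)) +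
    ((L.getLast?.toList.map (Bar.suffixBar i) : List (Bar V)) : Multiset (Bar V))

/-- The number of steps of the update if the map is injective: the initial scan, `t` steps for the
reduction, `ℓ²` comparisons for sorting, carrying over the intervals in `U`, computing and carrying
over the `ℓ - 1` sums, and writing down the prefix and the suffix. -/
def injTime (n i p : ℕ) (D : Multiset (Bar V)) (t : ℕ) (U : Multiset (Bar V))
    (L : List (Bar V)) : ℕ :=
  scanTime n i p D + t + L.length ^ 2 + (U.map (carryTime i)).sum +
    (List.zipWith (fun x y : Bar V =>
      sumTime n y.birth x.death + seqSize y.birth (x.death + 2)) L L.tail).sum +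
    (L.head?.toList.map fun x => seqSize x.birth i).sum +
    (L.getLast?.toList.map fun x => seqSize (i + 2) (x.death + 2)).sum

end Zigzag

end

noncomputable section

open scoped Classical DirectSum

namespace Zigzag

variable {V : Type u}

/-! The proof rests on a criterion that removes interval decompositions from the update
(`isRepBarcode_iff`): a multiset of valid representatives is the barcode as soon as, at every index
and in every dimension, the number of intervals passing through equals the Betti number. One arrow
changes a single Betti number by one, and a birth and a death at the same arrow would lie in
different dimensions, so the counts force exactly one birth or exactly one death there
(`IsRepFamily.events`). Induction along the zigzag then keeps the classes at each index linearly
independent (`IsRepFamily.indepAt`). Having the right number, they form bases, and these bases are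
compatible with all arrows (`IsRepFamily.nonempty_iso`).

The two cases are separated by the question whether `s` lies on some cycle of `F.cx i`
(`IsAddition.Creates`). If it does, removing `s` loses one class in dimension `p` and the inclusion
is injective; if not, it gains the class of the boundary of `s` in dimension `p - 1` and the
inclusion is surjective. Since `s` has no proper coface, no boundary contains it, so the coefficient
at `s` is a functional on homology. It is nonzero exactly if some representative in the basis at `i`
contains `s` (`touched_ne_zero_iff`).

A cycle that avoids `s` survives at the new index, so untouched intervals carry over. Touched ones
are paired: the sum of two of them avoids `s`. Representatives through `i` are split at `i` into
halves, and a sum takes the later birth in the order `≺_b` and the later death in the order `≺_d`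
(`IsRep.leftRep_sum`, `IsRep.rightRep_sum`). For `x ≺ y` the sum therefore represents the interval
of `y`, which is one reduction step and changes no count. Distinct births are always `≺_b`-related
and distinct deaths `≺_d`-related, so intervals left incomparable have opposite orders of births and
deaths, and neighbours can be linked. Linking merely recombines left and right halves, with one left
half and one right half remaining, so the counts are right everywhere, with one interval fewer at `i
+ 1` (`passing_links`).

For the running time, the number of intervals through `i` is the total Betti number of `F.cx i`,
hence at most `n`, and `n` is at most the length because every simplex is added by some arrow. -/

theorem zmod2_eq_one_of_ne_zero {a : ZMod 2} (h : a ≠ 0) : a = 1 := by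
  revert h; revert a; decide

theorem zmod2_add_self {M : Type*} [AddCommGroup M] [Module (ZMod 2) M] (x : M) : x + x = 0 := by
  rw [← two_smul (ZMod 2) x, show (2 : ZMod 2) = 0 from rfl, zero_smul]

theorem zmod2_sub {M : Type*} [AddCommGroup M] [Module (ZMod 2) M] (x y : M) :
    x - y = x + y := by
  rw [sub_eq_add_neg, neg_eq_of_add_eq_zero_left (zmod2_add_self y)]

/-! ### Chains and boundaries -/

theorem boundary_single (s : Finset V) (a : ZMod 2) :
    boundary (Finsupp.single s a) =
      a • (if s.card ≤ 1 then 0 else ∑ x ∈ s, Finsupp.single (s.erase x) 1 : Chain V) := by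
  rw [boundary, Finsupp.linearCombination_single]

/-- Exchanging the two removed vertices is an involution without fixed points on the summands, and
it pairs equal terms, which cancel mod 2. -/
theorem sum_erase_erase_eq_zero {M : Type*} [AddCommGroup M] [Module (ZMod 2) M] (s : Finset V)
    (f : Finset V → M) : ∑ x ∈ s, ∑ y ∈ s.erase x, f ((s.erase x).erase y) = 0 := by
  rw [Finset.sum_sigma']
  refine Finset.sum_involution (fun a _ => ⟨a.2, a.1⟩) ?_ ?_ ?_ ?_
  · rintro ⟨x, y⟩ h
    simp only [Finset.erase_right_comm (a := y) (b := x)]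
    exact zmod2_add_self _
  · rintro ⟨x, y⟩ h _ e
    simp only [Finset.mem_sigma, Finset.mem_erase] at h
    simp only [Sigma.mk.injEq] at e
    exact h.2.1 e.1
  · rintro ⟨x, y⟩ h
    simp only [Finset.mem_sigma, Finset.mem_erase] at h ⊢
    exact ⟨h.2.2, Ne.symm h.2.1, h.1⟩
  · rintro ⟨x, y⟩ h
    rfl

theorem boundary_boundary (c : Chain V) : boundary (boundary c) = 0 := by
  induction c using Finsupp.induction_linear with
  | zero => simp
  | add f g hf hg => simp [hf, hg]
  | single s a =>
    rw [boundary_single, map_smul]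
    split_ifs with h
    · simp
    · rw [map_sum]
      -- Edges are separate: homology is unreduced, so the boundary of a vertex is zero by
      -- convention and not the empty simplex given by the sum formula.
      by_cases h2 : s.card = 2
      · rw [Finset.sum_eq_zero, smul_zero]
        intro x hx
        rw [boundary_single, if_pos (by rw [Finset.card_erase_of_mem hx]; omega), smul_zero]
      · rw [Finset.sum_congr rfl (g := fun x => ∑ y ∈ s.erase x,
          (Finsupp.single ((s.erase x).erase y) 1 : Chain V)), sum_erase_erase_eq_zero s
          (fun t => (Finsupp.single t 1 : Chain V)), smul_zero]
        intro x hx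
        rw [boundary_single, if_neg (by rw [Finset.card_erase_of_mem hx]; omega), one_smul]

theorem mem_chains {K : Cplx V} {q : ℕ} {c : Chain V} :
    c ∈ chains K q ↔ ∀ t, c t ≠ 0 → t ∈ K ∧ t.card = q + 1 := by
  rw [chains, Finsupp.mem_supported]
  exact ⟨fun h t ht => h (Finsupp.mem_support_iff.2 ht),
    fun h t ht => h t (Finsupp.mem_support_iff.1 ht)⟩

theorem mem_cycles {K : Cplx V} {q : ℕ} {c : Chain V} :
    c ∈ cycles K q ↔ c ∈ chains K q ∧ boundary c = 0 := by
  rw [cycles, Submodule.mem_inf, LinearMap.mem_ker]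

theorem mem_boundaries {K : Cplx V} {q : ℕ} {c : Chain V} :
    c ∈ boundaries K q ↔ ∃ e ∈ chains K (q + 1), boundary e = c := Submodule.mem_map

theorem single_mem_chains {K : Cplx V} {q : ℕ} {s : Finset V} (hs : s ∈ K)
    (hq : s.card = q + 1) : (Finsupp.single s 1 : Chain V) ∈ chains K q :=
  Finsupp.single_mem_supported _ _ ⟨hs, hq⟩

theorem boundary_single_mem_chains {K : Cplx V} {q : ℕ} {s : Finset V}
    (hs : ∀ t, t ⊂ s → t.Nonempty → t ∈ K) (hq : s.card = q + 2) :
    boundary (Finsupp.single s 1 : Chain V) ∈ chains K q := by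
  rw [boundary_single, one_smul, if_neg (by omega)]
  refine Submodule.sum_mem _ fun x hx => ?_
  have hc : (s.erase x).card = q + 1 := by rw [Finset.card_erase_of_mem hx]; omega
  exact single_mem_chains (hs _ (Finset.erase_ssubset hx)
    (Finset.card_pos.1 (by omega))) hc

theorem face_mem {K : Cplx V} {s t : Finset V} (hs : s ∈ K) (hts : t ⊆ s) (ht : t.Nonempty) :
    t ∈ K := (K.isRelLowerSet_faces hs).2 hts ht

theorem boundary_mem_chains {K : Cplx V} {q : ℕ} {c : Chain V} (hc : c ∈ chains K (q + 1)) :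
    boundary c ∈ chains K q := by
  rw [chains, Finsupp.supported_eq_span_single] at hc
  induction hc using Submodule.span_induction with
  | mem x h =>
    obtain ⟨t, ht, rfl⟩ := h
    exact boundary_single_mem_chains (fun r hr hn => face_mem ht.1 hr.1 hn) ht.2
  | zero => simp
  | add x y _ _ hx hy => rw [map_add]; exact add_mem hx hy
  | smul a x _ hx => rw [map_smul]; exact Submodule.smul_mem _ _ hx

theorem boundaries_le_cycles (K : Cplx V) (q : ℕ) : boundaries K q ≤ cycles K q := by
  intro x hx
  obtain ⟨e, he, rfl⟩ := mem_boundaries.1 hx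
  exact mem_cycles.2 ⟨boundary_mem_chains he, boundary_boundary e⟩

theorem boundaries_mono {K L : Cplx V} (h : K ≤ L) (q : ℕ) : boundaries K q ≤ boundaries L q :=
  Submodule.map_mono (chains_mono h (q + 1))

/-- Boundaries do not contain simplices without proper cofaces. -/
theorem boundary_apply_eq_zero {K : Cplx V} {q : ℕ} {s : Finset V} {c : Chain V}
    (hs : ∀ t ∈ K, s ⊆ t → t = s) (hc : c ∈ chains K q) : boundary c s = 0 := by
  rw [chains, Finsupp.supported_eq_span_single] at hc
  induction hc using Submodule.span_induction with
  | mem x h =>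
    obtain ⟨t, ht, rfl⟩ := h
    simp only [boundary_single, one_smul]
    split_ifs
    · rfl
    · rw [Finsupp.finsetSum_apply]
      refine Finset.sum_eq_zero fun x hx => Finsupp.single_eq_of_ne ?_
      rintro rfl
      have := hs t ht.1 (Finset.erase_subset _ _)
      exact Finset.notMem_erase x t (this ▸ hx)
  | zero => simp
  | add x y _ _ hx hy => rw [map_add, Finsupp.add_apply, hx, hy, add_zero]
  | smul a x _ hx => rw [map_smul, Finsupp.smul_apply, hx, smul_zero]

/-! ### Addition of a simplex -/

namespace IsAddition

variable {K L : Cplx V} {s : Finset V}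

theorem mem_iff (h : IsAddition K s L) {t : Finset V} : t ∈ L ↔ t = s ∨ t ∈ K := by
  change t ∈ L.faces ↔ _
  rw [h.2]; rfl

theorem le (h : IsAddition K s L) : K ≤ L := fun _ ht => h.mem_iff.2 (Or.inr ht)

theorem mem (h : IsAddition K s L) : s ∈ L := h.mem_iff.2 (Or.inl rfl)

theorem not_le (h : IsAddition K s L) : ¬ L ≤ K := fun h' => h.1 (h' h.mem)

theorem nonempty (h : IsAddition K s L) : s.Nonempty := (L.isRelLowerSet_faces h.mem).1

theorem eq_of_subset (h : IsAddition K s L) : ∀ t ∈ L, s ⊆ t → t = s :=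
  fun _ ht hst =>
  (h.mem_iff.1 ht).resolve_right fun hK => h.1 (face_mem hK hst h.nonempty)

theorem apply_eq_zero (h : IsAddition K s L) {q : ℕ} {c : Chain V} (hc : c ∈ chains K q) :
    c s = 0 := by
  by_contra hne
  exact h.1 (mem_chains.1 hc s hne).1

theorem mem_chains_of_apply (h : IsAddition K s L) {q : ℕ} {c : Chain V} (hc : c ∈ chains L q)
    (h0 : c s = 0) : c ∈ chains K q := by
  refine mem_chains.2 fun _ ht => ?_
  obtain ⟨h1, h2⟩ := mem_chains.1 hc _ ht
  refine ⟨(h.mem_iff.1 h1).resolve_left ?_, h2⟩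
  rintro rfl
  exact ht h0

theorem mem_cycles_of_apply (h : IsAddition K s L) {q : ℕ} {c : Chain V} (hc : c ∈ cycles L q)
    (h0 : c s = 0) : c ∈ cycles K q :=
  mem_cycles.2 ⟨h.mem_chains_of_apply (mem_cycles.1 hc).1 h0, (mem_cycles.1 hc).2⟩

theorem boundary_apply (h : IsAddition K s L) {q : ℕ} {c : Chain V} (hc : c ∈ chains L q) :
    boundary c s = 0 := boundary_apply_eq_zero h.eq_of_subset hc

theorem boundaries_apply (h : IsAddition K s L) {q : ℕ} {c : Chain V}
    (hc : c ∈ boundaries L q) : c s = 0 := by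
  obtain ⟨e, he, rfl⟩ := mem_boundaries.1 hc
  exact h.boundary_apply he

theorem boundary_single_mem (h : IsAddition K s L) {q : ℕ} (hq : s.card = q + 2) :
    boundary (Finsupp.single s 1 : Chain V) ∈ cycles K q :=
  mem_cycles.2 ⟨boundary_single_mem_chains (fun _ ht hn =>
    (h.mem_iff.1 (face_mem h.mem ht.1 hn)).resolve_left ht.ne) hq, boundary_boundary _⟩

/-- The two chains containing the new simplex sum to an old chain. -/
theorem add_mem_chains (h : IsAddition K s L) {q : ℕ} {c e : Chain V} (hc : c ∈ chains L q)
    (he : e ∈ chains L q) (hcs : c s ≠ 0) (hes : e s ≠ 0) : c + e ∈ chains K q :=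
  h.mem_chains_of_apply (add_mem hc he) (by
    rw [Finsupp.add_apply, zmod2_eq_one_of_ne_zero hcs, zmod2_eq_one_of_ne_zero hes]; rfl)

theorem card_of_apply {q : ℕ} {c : Chain V} (hc : c ∈ chains L q) (h0 : c s ≠ 0) :
    s.card = q + 1 := (mem_chains.1 hc s h0).2

/-- The new simplex is contained in a cycle. -/
def Creates (L : Cplx V) (s : Finset V) : Prop := ∃ q, ∃ z ∈ cycles L q, z s ≠ 0

/-- A chain that uses `s` can be freed of it by adding a cycle through `s`, which does not change
its boundary. -/
theorem boundaries_of_creates (h : IsAddition K s L) (hp : Creates L s) {q : ℕ} {x : Chain V}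
    (hx : x ∈ boundaries L q) : x ∈ boundaries K q := by
  obtain ⟨p, z, hz, hzs⟩ := hp
  obtain ⟨e, he, rfl⟩ := mem_boundaries.1 hx
  by_cases hes : e s = 0
  · exact mem_boundaries.2 ⟨e, h.mem_chains_of_apply he hes, rfl⟩
  · obtain rfl : p = q + 1 := by
      have h1 := card_of_apply (mem_cycles.1 hz).1 hzs
      have h2 := card_of_apply he hes
      omega
    exact mem_boundaries.2 ⟨z + e, h.add_mem_chains (mem_cycles.1 hz).1 he hzs hes, by
      rw [map_add, (mem_cycles.1 hz).2, zero_add]⟩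

theorem cycles_of_not_creates (h : IsAddition K s L) (hp : ¬ Creates L s) {q : ℕ} {x : Chain V}
    (hx : x ∈ cycles L q) : x ∈ cycles K q := by
  refine h.mem_cycles_of_apply hx ?_
  by_contra hne
  exact hp ⟨q, x, hx, hne⟩

/-- A vertex is itself a cycle in unreduced homology. -/
theorem two_le_card_of_not_creates (h : IsAddition K s L) (hp : ¬ Creates L s) :
    2 ≤ s.card := by
  by_contra hlt
  have h1 := h.nonempty.card_pos
  refine hp ⟨0, Finsupp.single s 1, mem_cycles.2 ⟨single_mem_chains h.mem (by omega), ?_⟩, by simp⟩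
  rw [boundary_single, if_pos (by omega), smul_zero]

/-- An old chain with the same boundary as `s` would close `s` up to a cycle. -/
theorem boundary_single_notMem (h : IsAddition K s L) (hp : ¬ Creates L s) {q : ℕ}
    (hq : s.card = q + 2) : boundary (Finsupp.single s 1 : Chain V) ∉ boundaries K q := by
  intro hm
  obtain ⟨e, he, he'⟩ := mem_boundaries.1 hm
  refine hp ⟨q + 1, Finsupp.single s 1 + e, mem_cycles.2 ⟨add_mem (single_mem_chains h.mem hq)
    (chains_mono h.le _ he), by rw [map_add, he', zmod2_add_self]⟩, ?_⟩
  rw [Finsupp.add_apply, h.apply_eq_zero he]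
  simp

theorem boundaries_eq_of_card_ne (h : IsAddition K s L) {q : ℕ} (hq : s.card ≠ q + 2) :
    boundaries L q = boundaries K q := by
  refine le_antisymm ?_ (boundaries_mono h.le q)
  intro x hx
  obtain ⟨e, he, rfl⟩ := mem_boundaries.1 hx
  refine mem_boundaries.2 ⟨e, h.mem_chains_of_apply he ?_, rfl⟩
  by_contra hne
  exact hq (card_of_apply he hne)

theorem cycles_eq_of_card_ne (h : IsAddition K s L) {q : ℕ} (hq : s.card ≠ q + 1) :
    cycles L q = cycles K q := by
  refine le_antisymm ?_ (cycles_mono h.le q)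
  intro x hx
  refine h.mem_cycles_of_apply hx ?_
  by_contra hne
  exact hq (card_of_apply (mem_cycles.1 hx).1 hne)

theorem cycles_eq_sup (h : IsAddition K s L) {q : ℕ} {z : Chain V} (hz : z ∈ cycles L q)
    (hzs : z s ≠ 0) : cycles L q = cycles K q ⊔ Submodule.span (ZMod 2) {z} := by
  refine le_antisymm ?_ (sup_le (cycles_mono h.le q) ?_)
  · intro x hx
    by_cases hxs : x s = 0
    · exact Submodule.mem_sup_left (h.mem_cycles_of_apply hx hxs)
    · have : x + z ∈ cycles K q := h.mem_cycles_of_apply (add_mem hx hz) (by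
        rw [Finsupp.add_apply, zmod2_eq_one_of_ne_zero hxs, zmod2_eq_one_of_ne_zero hzs]; rfl)
      rw [show x = (x + z) + z by rw [add_assoc, zmod2_add_self, add_zero]]
      exact add_mem (Submodule.mem_sup_left this)
        (Submodule.mem_sup_right (Submodule.mem_span_singleton_self z))
  · rw [Submodule.span_singleton_le_iff_mem]; exact hz

theorem boundaries_eq_sup (h : IsAddition K s L) {q : ℕ} (hq : s.card = q + 2) :
    boundaries L q = boundaries K q ⊔
      Submodule.span (ZMod 2) {boundary (Finsupp.single s 1 : Chain V)} := by
  refine le_antisymm ?_ (sup_le (boundaries_mono h.le q) ?_)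
  · intro x hx
    obtain ⟨e, he, rfl⟩ := mem_boundaries.1 hx
    by_cases hes : e s = 0
    · exact Submodule.mem_sup_left (mem_boundaries.2 ⟨e, h.mem_chains_of_apply he hes, rfl⟩)
    · have : e + Finsupp.single s 1 ∈ chains K (q + 1) :=
        h.add_mem_chains he (single_mem_chains h.mem hq) hes (by simp)
      rw [show e = (e + Finsupp.single s 1) + Finsupp.single s 1 by
        rw [add_assoc, zmod2_add_self, add_zero], map_add]
      exact add_mem (Submodule.mem_sup_left (mem_boundaries.2 ⟨_, this, rfl⟩))
        (Submodule.mem_sup_right (Submodule.mem_span_singleton_self _))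
  · rw [Submodule.span_singleton_le_iff_mem]
    exact mem_boundaries.2 ⟨_, single_mem_chains h.mem hq, rfl⟩

end IsAddition

/-! ### Betti numbers -/

/-- The rank of `H_q(K)`. -/
def betti (K : Cplx V) (q : ℕ) : ℕ := Module.finrank (ZMod 2) (Homology K q)

theorem finite_chains {K : Cplx V} (hK : K.faces.Finite) (q : ℕ) :
    Module.Finite (ZMod 2) (chains K q) := by
  have : Finite {s | s ∈ K ∧ s.card = q + 1} := (hK.subset fun s hs => hs.1).to_subtype
  exact Module.Finite.equiv
    (Finsupp.supportedEquivFinsupp (M := ZMod 2) (R := ZMod 2) {s | s ∈ K ∧ s.card = q + 1}).symm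

theorem finite_cycles {K : Cplx V} (hK : K.faces.Finite) (q : ℕ) :
    Module.Finite (ZMod 2) (cycles K q) :=
  have := finite_chains hK q
  Submodule.finiteDimensional_of_le (inf_le_left : cycles K q ≤ chains K q)

theorem finite_boundaries {K : Cplx V} (hK : K.faces.Finite) (q : ℕ) :
    Module.Finite (ZMod 2) (boundaries K q) :=
  have := finite_cycles hK q
  Submodule.finiteDimensional_of_le (boundaries_le_cycles K q)

theorem finite_homology {K : Cplx V} (hK : K.faces.Finite) (q : ℕ) :
    Module.Finite (ZMod 2) (Homology K q) :=
  have := finite_cycles hK q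
  Module.Finite.quotient _ _

/-- The additive form avoids truncated subtraction in the rank computations. -/
theorem betti_add {K : Cplx V} (hK : K.faces.Finite) (q : ℕ) :
    betti K q + Module.finrank (ZMod 2) (boundaries K q) =
      Module.finrank (ZMod 2) (cycles K q) := by
  have := finite_cycles hK q
  rw [← (Submodule.comapSubtypeEquivOfLe (boundaries_le_cycles K q)).finrank_eq]
  exact Submodule.finrank_quotient_add_finrank _

theorem finrank_sup_span {M : Type*} [AddCommGroup M] [Module (ZMod 2) M]
    (W : Submodule (ZMod 2) M) [Module.Finite (ZMod 2) W] {v : M} (hv : v ∉ W) :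
    Module.finrank (ZMod 2) (W ⊔ Submodule.span (ZMod 2) {v} : Submodule (ZMod 2) M) =
      Module.finrank (ZMod 2) W + 1 := by
  have h := Submodule.finrank_sup_add_finrank_inf_eq W (Submodule.span (ZMod 2) {v})
  have hv0 : v ≠ 0 := fun h => hv (h ▸ W.zero_mem)
  rw [(Submodule.disjoint_span_singleton' hv0).2 hv |>.eq_bot, finrank_bot,
    finrank_span_singleton hv0] at h
  simpa using h

/-- The homology class of a cycle. -/
def homologyClass (K : Cplx V) (q : ℕ) : cycles K q →ₗ[ZMod 2] Homology K q :=
  Submodule.mkQ _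

theorem homologyClass_surjective (K : Cplx V) (q : ℕ) :
    Function.Surjective (homologyClass K q) := Submodule.mkQ_surjective _

theorem homologyClass_eq_zero {K : Cplx V} {q : ℕ} {z : cycles K q} :
    homologyClass K q z = 0 ↔ (z : Chain V) ∈ boundaries K q :=
  Submodule.Quotient.mk_eq_zero _

theorem homologyClass_eq {K : Cplx V} {q : ℕ} {y z : cycles K q} :
    homologyClass K q y = homologyClass K q z ↔ (y : Chain V) + z ∈ boundaries K q := by
  rw [← sub_eq_zero, ← map_sub, homologyClass_eq_zero, zmod2_sub]; rfl

theorem homologyMap_homologyClass {K L : Cplx V} (h : K ≤ L) (q : ℕ) (z : cycles K q) :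
    homologyMap h q (homologyClass K q z) =
      homologyClass L q ⟨z, cycles_mono h q z.2⟩ := rfl

namespace IsAddition

variable {K L : Cplx V} {s : Finset V}

theorem finite (h : IsAddition K s L) (hK : K.faces.Finite) : L.faces.Finite := by
  rw [h.2]; exact hK.insert s

/-- Boundaries are unchanged in every degree, and the cycles gain one generator in the degree of `s`
only. -/
theorem betti_of_creates (h : IsAddition K s L) (hK : K.faces.Finite) (hp : Creates L s) (q : ℕ) :
    betti L q = betti K q + if s.card = q + 1 then 1 else 0 := by
  have hL := h.finite hK
  have e1 := betti_add hK q
  have e2 := betti_add hL q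
  have hB : boundaries L q = boundaries K q :=
    le_antisymm (fun x hx => h.boundaries_of_creates hp hx) (boundaries_mono h.le q)
  rw [hB] at e2
  split_ifs with hq
  · obtain ⟨r, z, hz, hzs⟩ := hp
    obtain rfl : r = q := by
      have := card_of_apply (mem_cycles.1 hz).1 hzs
      omega
    have := finite_cycles hK r
    rw [h.cycles_eq_sup hz hzs, finrank_sup_span _
      fun hm => hzs (h.apply_eq_zero (mem_cycles.1 hm).1)] at e2
    omega
  · rw [h.cycles_eq_of_card_ne hq] at e2
    omega

/-- Cycles are unchanged in every degree, and the boundaries gain the boundary of `s` only. -/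
theorem betti_of_not_creates (h : IsAddition K s L) (hK : K.faces.Finite) (hp : ¬ Creates L s)
    (q : ℕ) : betti K q = betti L q + if s.card = q + 2 then 1 else 0 := by
  have hL := h.finite hK
  have e1 := betti_add hK q
  have e2 := betti_add hL q
  have hB : cycles L q = cycles K q :=
    le_antisymm (fun x hx => h.cycles_of_not_creates hp hx) (cycles_mono h.le q)
  rw [hB] at e2
  split_ifs with hq
  · have := finite_boundaries hK q
    rw [h.boundaries_eq_sup hq, finrank_sup_span _ (h.boundary_single_notMem hp hq)] at e2
    omega
  · rw [h.boundaries_eq_of_card_ne hq] at e2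
    omega

/-! ### The map induced by the inclusion -/

/-- The boundary of `s` is a cycle of `K` that dies in `L`. It already bounds in `K` if `s` lies on
a cycle, and it is a nonzero kernel class otherwise. -/
theorem injective_iff_creates (h : IsAddition K s L) :
    (∀ q, Function.Injective (homologyMap h.le q)) ↔ Creates L s := by
  have key : ∀ q, Function.Injective (homologyMap h.le q) ↔
      ∀ z ∈ cycles K q, z ∈ boundaries L q → z ∈ boundaries K q := by
    intro q
    rw [injective_iff_map_eq_zero]
    constructor
    · intro hi z hz hzL
      exact homologyClass_eq_zero.1 (hi (homologyClass K q ⟨z, hz⟩) (homologyClass_eq_zero.2 hzL))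
    · intro hi a
      obtain ⟨⟨z, hz⟩, rfl⟩ := homologyClass_surjective K q a
      intro ha
      exact homologyClass_eq_zero.2 (hi z hz (homologyClass_eq_zero.1 ha))
  constructor
  · intro hi
    by_contra hp
    have h2 := h.two_le_card_of_not_creates hp
    obtain ⟨q, hq⟩ : ∃ q, s.card = q + 2 := ⟨s.card - 2, by omega⟩
    exact h.boundary_single_notMem hp hq ((key q).1 (hi q) _ (h.boundary_single_mem hq)
      (mem_boundaries.2 ⟨_, single_mem_chains h.mem hq, rfl⟩))
  · intro hp q
    exact (key q).2 fun z _ hz => h.boundaries_of_creates hp hz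

/-- The coefficient at `s` depends only on the homology class in `L` and vanishes on the image, so a
cycle through `s` is an obstruction. Without such a cycle, all cycles of `L` already lie in `K`. -/
theorem surjective_iff_not_creates (h : IsAddition K s L) :
    (∀ q, Function.Surjective (homologyMap h.le q)) ↔ ¬ Creates L s := by
  constructor
  · rintro hs ⟨q, z, hz, hzs⟩
    obtain ⟨a, ha⟩ := hs q (homologyClass L q ⟨z, hz⟩)
    obtain ⟨⟨y, hy⟩, rfl⟩ := homologyClass_surjective K q a
    have h3 : y s + z s = 0 := h.boundaries_apply (homologyClass_eq.1 ha)
    rw [h.apply_eq_zero (mem_cycles.1 hy).1, zero_add] at h3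
    exact hzs h3
  · intro hp q a
    obtain ⟨⟨z, hz⟩, rfl⟩ := homologyClass_surjective L q a
    exact ⟨homologyClass K q ⟨z, h.cycles_of_not_creates hp hz⟩, rfl⟩

end IsAddition

namespace Filtration

theorem isAddition_of_fwd (F : Filtration V) {k : ℕ} (hk : k < F.len) (h : F.fwd k) :
    IsAddition (F.cx k) (F.sx k) (F.cx (k + 1)) :=
  (F.step k hk).resolve_right fun h' => h'.not_le h

theorem isAddition_of_not_fwd (F : Filtration V) {k : ℕ} (hk : k < F.len) (h : ¬ F.fwd k) :
    IsAddition (F.cx (k + 1)) (F.sx k) (F.cx k) :=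
  (F.step k hk).resolve_left fun h' => h h'.le

theorem finite_faces (F : Filtration V) : ∀ k ≤ F.len, (F.cx k).faces.Finite
  | 0, _ => by
    rw [F.cx_zero]
    exact Set.finite_empty
  | k + 1, hk => by
    have ih := F.finite_faces k (by omega)
    rcases F.step k (by omega) with h | h
    · exact h.finite ih
    · exact ih.subset h.le

end Filtration

/-! ### Representatives at one arrow -/

namespace Bar

namespace IsRep

variable {F : Filtration V} {x : Bar V} {k : ℕ}

theorem add_mem_boundaries_of_fwd (hx : x.IsRep F) (h1 : x.birth ≤ k) (h2 : k < x.death)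
    (hf : F.fwd k) : x.z k + x.z (k + 1) ∈ boundaries (F.cx (k + 1)) x.dim := by
  have := hx.chain k h1 h2
  rw [if_pos hf] at this
  exact mem_boundaries.2 ⟨_, this.1, this.2.symm⟩

theorem add_mem_boundaries_of_not_fwd (hx : x.IsRep F) (h1 : x.birth ≤ k) (h2 : k < x.death)
    (hf : ¬ F.fwd k) : x.z k + x.z (k + 1) ∈ boundaries (F.cx k) x.dim := by
  have := hx.chain k h1 h2
  rw [if_neg hf] at this
  exact mem_boundaries.2 ⟨_, this.1, this.2.symm⟩

theorem birth_of_fwd (hx : x.IsRep F) (hb : x.birth = k + 1) (hf : F.fwd k) :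
    x.z (k + 1) (F.sx k) ≠ 0 := by
  have := hx.birth_forward
  rw [hb, Nat.add_sub_cancel] at this
  exact Finsupp.mem_support_iff.1 (this hf)

theorem birth_of_not_fwd (hx : x.IsRep F) (hb : x.birth = k + 1) (hf : ¬ F.fwd k) :
    x.c k ∈ chains (F.cx k) (x.dim + 1) ∧ x.c k (F.sx k) ≠ 0 ∧
      x.z (k + 1) = boundary (x.c k) := by
  have := hx.birth_backward
  rw [hb, Nat.add_sub_cancel] at this
  exact ⟨(this hf).1, Finsupp.mem_support_iff.1 (this hf).2.1, (this hf).2.2⟩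

theorem death_of_fwd (hx : x.IsRep F) (hd : x.death = k) (hf : F.fwd k) :
    x.c k ∈ chains (F.cx (k + 1)) (x.dim + 1) ∧ x.c k (F.sx k) ≠ 0 ∧
      x.z k = boundary (x.c k) := by
  subst hd
  have := hx.death_forward hf
  exact ⟨this.1, Finsupp.mem_support_iff.1 this.2.1, this.2.2⟩

theorem death_of_not_fwd (hx : x.IsRep F) (hd : x.death = k) (hf : ¬ F.fwd k) :
    x.z k (F.sx k) ≠ 0 := by
  subst hd
  exact Finsupp.mem_support_iff.1 (hx.death_backward hf)

theorem z_mem_chains (hx : x.IsRep F) (h : x.Contains k) : x.z k ∈ chains (F.cx k) x.dim :=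
  (mem_cycles.1 (hx.cycle k h)).1

/-- A representative that crosses an arrow avoids its simplex: the two cycles differ by a boundary,
which cannot contain a simplex without proper cofaces, and the cycle on the smaller side does not
contain it either. Hence adding such a representative to one that is born at this arrow preserves
the birth condition. -/
theorem z_succ_apply_of_fwd (hx : x.IsRep F) (hk : k < F.len) (h1 : x.birth ≤ k)
    (h2 : k < x.death) (hf : F.fwd k) : x.z (k + 1) (F.sx k) = 0 := by
  have ha := F.isAddition_of_fwd hk hf
  have h := ha.boundaries_apply (hx.add_mem_boundaries_of_fwd h1 h2 hf)
  rwa [Finsupp.add_apply, ha.apply_eq_zero (hx.z_mem_chains ⟨h1, h2.le⟩), zero_add] at h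

theorem z_apply_of_not_fwd (hx : x.IsRep F) (hk : k < F.len) (h1 : x.birth ≤ k)
    (h2 : k < x.death) (hf : ¬ F.fwd k) : x.z k (F.sx k) = 0 := by
  have ha := F.isAddition_of_not_fwd hk hf
  have h := ha.boundaries_apply (hx.add_mem_boundaries_of_not_fwd h1 h2 hf)
  rwa [Finsupp.add_apply, ha.apply_eq_zero (hx.z_mem_chains ⟨by omega, h2⟩), add_zero] at h

end IsRep

end Bar

/-! ### Families of representatives -/

/-- A combination of cycles at `k + 1` may be replaced by the one at `k`, up to boundaries. -/
theorem sum_mem_of_sum_succ_mem {ι : Type*} {X : ι → Bar V} {k : ℕ} {L : Cplx V} {q : ℕ}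
    {S : Finset ι} {a : ι → ZMod 2}
    (h : ∀ j ∈ S, (X j).z k + (X j).z (k + 1) ∈ boundaries L q)
    (hS : ∑ j ∈ S, a j • (X j).z (k + 1) ∈ boundaries L q) :
    ∑ j ∈ S, a j • (X j).z k ∈ boundaries L q := by
  have h1 : ∑ j ∈ S, a j • ((X j).z k + (X j).z (k + 1)) ∈ boundaries L q :=
    Submodule.sum_mem _ fun j hj => Submodule.smul_mem _ _ (h j hj)
  simp only [smul_add, Finset.sum_add_distrib] at h1
  exact (Submodule.add_mem_iff_left _ hS).1 h1

section Family

variable {ι : Type*} [Fintype ι]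

/-- The members of a family of intervals that have dimension `q` and contain `k`. -/
def active (X : ι → Bar V) (k q : ℕ) : Finset ι :=
  Finset.univ.filter fun j => (X j).dim = q ∧ (X j).Contains k

theorem mem_active {X : ι → Bar V} {k q : ℕ} {j : ι} :
    j ∈ active X k q ↔ (X j).dim = q ∧ (X j).birth ≤ k ∧ k ≤ (X j).death := by
  rw [active, Finset.mem_filter, Bar.Contains]
  exact and_iff_right (Finset.mem_univ j)

/-- The family consists of representatives, and as many of them pass through each index as the
Betti number prescribes. -/
structure IsRepFamily (F : Filtration V) (X : ι → Bar V) : Prop where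
  isRep : ∀ j, (X j).IsRep F
  card_active : ∀ k ≤ F.len, ∀ q, (active X k q).card = betti (F.cx k) q

/-- Exactly one interval is born at `k + 1`, and none dies at `k`. -/
def UniqueBirth (X : ι → Bar V) (k : ℕ) : Prop :=
  (∃! j, (X j).birth = k + 1) ∧ ∀ j, (X j).death ≠ k

/-- Exactly one interval dies at `k`, and none is born at `k + 1`. -/
def UniqueDeath (X : ι → Bar V) (k : ℕ) : Prop :=
  (∃! j, (X j).death = k) ∧ ∀ j, (X j).birth ≠ k + 1

/-- Both sides count the intervals of dimension `q` with birth at most `k + 1` and death at least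
`k`. -/
theorem card_active_succ (X : ι → Bar V) (hX : ∀ j, (X j).birth ≤ (X j).death) (k q : ℕ) :
    (active X (k + 1) q).card +
      (Finset.univ.filter fun j => (X j).dim = q ∧ (X j).death = k).card =
    (active X k q).card +
      (Finset.univ.filter fun j => (X j).dim = q ∧ (X j).birth = k + 1).card := by
  rw [← Finset.card_union_of_disjoint, ← Finset.card_union_of_disjoint]
  · congr 1
    ext j
    have := hX j
    simp only [Finset.mem_union, mem_active, Finset.mem_filter, Finset.mem_univ, true_and]
    omega
  · rw [Finset.disjoint_left]
    intro j
    simp only [mem_active, Finset.mem_filter, Finset.mem_univ, true_and]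
    omega
  · rw [Finset.disjoint_left]
    intro j
    simp only [mem_active, Finset.mem_filter, Finset.mem_univ, true_and]
    omega

theorem existsUnique_of_card_filter {f g : ι → ℕ} {q n : ℕ}
    (hf : ∀ j, g j = n → f j = q)
    (h : (Finset.univ.filter fun j => f j = q ∧ g j = n).card = 1) : ∃! j, g j = n := by
  obtain ⟨j, hj⟩ := Finset.card_eq_one.1 h
  have key : ∀ l, g l = n ↔ l = j := by
    intro l
    have := Finset.ext_iff.1 hj l
    simp only [Finset.mem_filter, Finset.mem_univ, true_and, Finset.mem_singleton] at this
    exact ⟨fun h => this.1 ⟨hf l h, h⟩, fun h => (this.2 h).2⟩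
  exact ⟨j, (key j).2 rfl, fun l hl => (key l).1 hl⟩

section Events

variable {F : Filtration V} {X : ι → Bar V} {k c α β : ℕ}

/-- Here `c` is the number of vertices of the simplex at the arrow, and `α`, `β` are `1` and `2` in
the order given by the direction of the arrow. As they differ, births and deaths occur in different
dimensions and cannot compensate each other in the count. -/
theorem uniqueBirth_of_betti (hX : IsRepFamily F X) (hk : k < F.len)
    (hb : ∀ j, (X j).birth = k + 1 → c = (X j).dim + α)
    (hd : ∀ j, (X j).death = k → c = (X j).dim + β) (hαβ : α ≠ β) (hα : α ≤ c)
    (h : ∀ q, betti (F.cx (k + 1)) q = betti (F.cx k) q + if c = q + α then 1 else 0) :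
    UniqueBirth X k := by
  have key := fun q => card_active_succ X (fun j => (hX.isRep j).birth_le_death) k q
  simp only [hX.card_active k hk.le, hX.card_active (k + 1) hk, h] at key
  have hdd : ∀ q, (Finset.univ.filter fun j => (X j).dim = q ∧ (X j).death = k).card = 0 := by
    intro q
    by_cases hq : c = q + β
    · have h1 := key q
      have h2 : (Finset.univ.filter fun j => (X j).dim = q ∧ (X j).birth = k + 1).card = 0 := by
        rw [Finset.card_eq_zero, Finset.filter_eq_empty_iff]
        rintro j - ⟨h3, h4⟩
        have := hb j h4
        omega
      omega
    · rw [Finset.card_eq_zero, Finset.filter_eq_empty_iff]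
      rintro j - ⟨h3, h4⟩
      have := hd j h4
      omega
  constructor
  · refine existsUnique_of_card_filter (f := fun j => (X j).dim)
      (g := fun j => (X j).birth) (q := c - α)
      (fun j hj => ?_) ?_
    · have := hb j hj
      omega
    · have h1 := key (c - α)
      rw [if_pos (by omega), hdd] at h1
      omega
  · intro j hj
    have := hdd (X j).dim
    rw [Finset.card_eq_zero, Finset.filter_eq_empty_iff] at this
    exact this (Finset.mem_univ j) ⟨rfl, hj⟩

theorem uniqueDeath_of_betti (hX : IsRepFamily F X) (hk : k < F.len)
    (hb : ∀ j, (X j).birth = k + 1 → c = (X j).dim + α)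
    (hd : ∀ j, (X j).death = k → c = (X j).dim + β) (hαβ : α ≠ β) (hβ : β ≤ c)
    (h : ∀ q, betti (F.cx k) q = betti (F.cx (k + 1)) q + if c = q + β then 1 else 0) :
    UniqueDeath X k := by
  have key := fun q => card_active_succ X (fun j => (hX.isRep j).birth_le_death) k q
  simp only [hX.card_active k hk.le, hX.card_active (k + 1) hk, h] at key
  have hbb : ∀ q,
      (Finset.univ.filter fun j => (X j).dim = q ∧ (X j).birth = k + 1).card = 0 := by
    intro q
    by_cases hq : c = q + α
    · have h1 := key q
      have h2 : (Finset.univ.filter fun j => (X j).dim = q ∧ (X j).death = k).card = 0 := by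
        rw [Finset.card_eq_zero, Finset.filter_eq_empty_iff]
        rintro j - ⟨h3, h4⟩
        have := hd j h4
        omega
      omega
    · rw [Finset.card_eq_zero, Finset.filter_eq_empty_iff]
      rintro j - ⟨h3, h4⟩
      have := hb j h4
      omega
  constructor
  · refine existsUnique_of_card_filter (f := fun j => (X j).dim)
      (g := fun j => (X j).death) (q := c - β)
      (fun j hj => ?_) ?_
    · have := hd j hj
      omega
    · have h1 := key (c - β)
      rw [if_pos (by omega), hbb] at h1
      omega
  · intro j hj
    have := hbb (X j).dim
    rw [Finset.card_eq_zero, Finset.filter_eq_empty_iff] at this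
    exact this (Finset.mem_univ j) ⟨rfl, hj⟩

/-! ### The single event at each arrow, and independence of the classes -/

open IsAddition

/-- The added simplex lies in the cycle of an interval born here, hence has `dim + 1` vertices, or
in the bounding chain of one that dies here, hence has `dim + 2`. The change of the Betti numbers
selects the alternative. -/
theorem IsRepFamily.events_fwd (hX : IsRepFamily F X) (hk : k < F.len) (hf : F.fwd k) :
    (Creates (F.cx (k + 1)) (F.sx k) ∧ UniqueBirth X k) ∨
      (¬ Creates (F.cx (k + 1)) (F.sx k) ∧ UniqueDeath X k) := by
  have ha := F.isAddition_of_fwd hk hf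
  have hK := F.finite_faces k hk.le
  have hb : ∀ j, (X j).birth = k + 1 → (F.sx k).card = (X j).dim + 1 := fun j hj =>
    card_of_apply ((hX.isRep j).z_mem_chains
      ⟨hj.le, hj ▸ (hX.isRep j).birth_le_death⟩) ((hX.isRep j).birth_of_fwd hj hf)
  have hd : ∀ j, (X j).death = k → (F.sx k).card = (X j).dim + 2 := fun j hj =>
    card_of_apply ((hX.isRep j).death_of_fwd hj hf).1 ((hX.isRep j).death_of_fwd hj hf).2.1
  by_cases hp : Creates (F.cx (k + 1)) (F.sx k)
  · exact Or.inl ⟨hp, uniqueBirth_of_betti hX hk hb hd (by omega) ha.nonempty.card_pos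
      (ha.betti_of_creates hK hp)⟩
  · exact Or.inr ⟨hp, uniqueDeath_of_betti hX hk hb hd (by omega)
      (ha.two_le_card_of_not_creates hp) (ha.betti_of_not_creates hK hp)⟩

theorem IsRepFamily.events_not_fwd (hX : IsRepFamily F X) (hk : k < F.len) (hf : ¬ F.fwd k) :
    (¬ Creates (F.cx k) (F.sx k) ∧ UniqueBirth X k) ∨
      (Creates (F.cx k) (F.sx k) ∧ UniqueDeath X k) := by
  have ha := F.isAddition_of_not_fwd hk hf
  have hK := F.finite_faces (k + 1) hk
  have hb : ∀ j, (X j).birth = k + 1 → (F.sx k).card = (X j).dim + 2 := fun j hj =>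
    card_of_apply ((hX.isRep j).birth_of_not_fwd hj hf).1
      ((hX.isRep j).birth_of_not_fwd hj hf).2.1
  have hd : ∀ j, (X j).death = k → (F.sx k).card = (X j).dim + 1 := fun j hj =>
    card_of_apply ((hX.isRep j).z_mem_chains
      ⟨hj ▸ (hX.isRep j).birth_le_death, hj.ge⟩) ((hX.isRep j).death_of_not_fwd hj hf)
  by_cases hp : Creates (F.cx k) (F.sx k)
  · exact Or.inr ⟨hp, uniqueDeath_of_betti hX hk hb hd (by omega) ha.nonempty.card_pos
      (ha.betti_of_creates hK hp)⟩
  · exact Or.inl ⟨hp, uniqueBirth_of_betti hX hk hb hd (by omega)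
      (ha.two_le_card_of_not_creates hp) (ha.betti_of_not_creates hK hp)⟩

theorem IsRepFamily.events (hX : IsRepFamily F X) (hk : k < F.len) :
    UniqueBirth X k ∨ UniqueDeath X k := by
  by_cases hf : F.fwd k
  · exact (hX.events_fwd hk hf).imp And.right And.right
  · exact (hX.events_not_fwd hk hf).imp And.right And.right

theorem IsRepFamily.birth_injective (hX : IsRepFamily F X) :
    Function.Injective fun j => (X j).birth := by
  intro j l (h : (X j).birth = (X l).birth)
  have h1 := (hX.isRep j).one_le_birth
  have h2 := (hX.isRep j).birth_le_death
  have h3 := (hX.isRep j).death_lt_len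
  rcases hX.events (k := (X j).birth - 1) (by omega) with h' | h'
  · exact h'.1.unique (by omega) (by omega)
  · exact absurd (by omega) (h'.2 j)

theorem IsRepFamily.death_injective (hX : IsRepFamily F X) :
    Function.Injective fun j => (X j).death := by
  intro j l (h : (X j).death = (X l).death)
  rcases hX.events (hX.isRep j).death_lt_len with h' | h'
  · exact absurd rfl (h'.2 j)
  · exact h'.1.unique rfl h.symm

/-- The classes at `k` of the members of dimension `q` are linearly independent. -/
def IndepAt (F : Filtration V) (X : ι → Bar V) (k q : ℕ) : Prop :=
  ∀ a : ι → ZMod 2, ∑ j ∈ active X k q, a j • (X j).z k ∈ boundaries (F.cx k) q →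
    ∀ j ∈ active X k q, a j = 0

/-- At a birth, the coefficient at the new simplex isolates the newborn cycle, and the rest of a
relation moves back to `k`. At a death, a relation moved back to `k` may hold only through the new
simplex; correcting it by the dying interval gives a relation in the old complex. -/
theorem IndepAt.succ_of_fwd (hX : IsRepFamily F X) (hk : k < F.len) (hf : F.fwd k) {q : ℕ}
    (ih : IndepAt F X k q) : IndepAt F X (k + 1) q := by
  have ha := F.isAddition_of_fwd hk hf
  intro a hsum
  rcases hX.events_fwd hk hf with ⟨hp, ⟨y, hy, huniq⟩, hd⟩ | ⟨hp, ⟨y, hy, huniq⟩, hb⟩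
  · have hsub : active X k q ⊆ active X (k + 1) q := by
      intro j hj
      rw [mem_active] at hj ⊢
      have := hd j
      omega
    have hnew : ∀ j ∈ active X (k + 1) q, j ∉ active X k q → j = y := by
      intro j hj hj'
      rw [mem_active] at hj hj'
      exact huniq j (by omega)
    have hay : ∀ j ∈ active X (k + 1) q, j ∉ active X k q → a j = 0 := by
      intro j hj hj'
      -- Neither the boundary nor the older cycles contain the new simplex, so its coefficient in
      -- the relation is that of the newborn cycle alone.
      have h0 := ha.boundaries_apply hsum
      rw [Finsupp.finsetSum_apply, Finset.sum_eq_single j, Finsupp.smul_apply, smul_eq_mul,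
        mul_eq_zero] at h0
      · exact h0.resolve_right ((hX.isRep j).birth_of_fwd (hnew j hj hj' ▸ hy) hf)
      · intro l hl hlj
        have hl' : l ∈ active X k q := by
          by_contra h
          exact hlj ((hnew l hl h).trans (hnew j hj hj').symm)
        rw [mem_active] at hl hl'
        rw [Finsupp.smul_apply, (hX.isRep l).z_succ_apply_of_fwd hk hl'.2.1 hl.2.2 hf, smul_zero]
      · exact fun h => absurd hj h
    have h1 : ∑ j ∈ active X k q, a j • (X j).z (k + 1) ∈ boundaries (F.cx (k + 1)) q := by
      rwa [Finset.sum_subset hsub fun j hj hj' => by rw [hay j hj hj', zero_smul]]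
    have h2 := sum_mem_of_sum_succ_mem (fun j hj => by
      have hj' := hsub hj
      rw [mem_active] at hj hj'
      exact hj.1 ▸ (hX.isRep j).add_mem_boundaries_of_fwd hj.2.1 hj'.2.2 hf) h1
    intro j hj
    by_cases hj' : j ∈ active X k q
    · exact ih a (ha.boundaries_of_creates hp h2) j hj'
    · exact hay j hj hj'
  · have hsub : active X (k + 1) q ⊆ active X k q := by
      intro j hj
      rw [mem_active] at hj ⊢
      have := hb j
      omega
    have h2 := sum_mem_of_sum_succ_mem (fun j hj => by
      have hj' := hsub hj
      rw [mem_active] at hj hj'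
      exact hj.1 ▸ (hX.isRep j).add_mem_boundaries_of_fwd hj'.2.1 hj.2.2 hf) hsum
    have hyd := (hX.isRep y).death_of_fwd hy hf
    have hcard := card_of_apply hyd.1 hyd.2.1
    by_cases hyq : (X y).dim = q
    · have hya : active X k q = insert y (active X (k + 1) q) := by
        ext j
        rw [Finset.mem_insert, mem_active, mem_active]
        constructor
        · intro h
          by_cases hj : (X j).death = k
          · exact Or.inl (huniq j hj)
          · omega
        · rintro (rfl | h)
          · exact ⟨hyq, hy ▸ (hX.isRep j).birth_le_death, hy.ge⟩
          · have := hb j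
            omega
      have hyn : y ∉ active X (k + 1) q := by
        rw [mem_active]
        omega
      -- The relation extended to the dying interval `y` with a coefficient `r` still to be chosen.
      have hsum' : ∀ r : ZMod 2, ∑ j ∈ active X k q, Function.update a y r j • (X j).z k =
          r • (X y).z k + ∑ j ∈ active X (k + 1) q, a j • (X j).z k := by
        intro r
        rw [hya, Finset.sum_insert hyn, Function.update_self]
        congr 1
        refine Finset.sum_congr rfl fun j hj => ?_
        rw [Function.update_of_ne]
        rintro rfl
        exact hyn hj
      obtain ⟨e, he, hee⟩ := mem_boundaries.1 h2
      by_cases hes : e (F.sx k) = 0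
      · intro j hj
        have := ih (Function.update a y 0) (by
          rw [hsum', zero_smul, zero_add]
          exact mem_boundaries.2 ⟨e, ha.mem_chains_of_apply he hes, hee⟩) j (hsub hj)
        rwa [Function.update_of_ne] at this
        rintro rfl
        exact hyn hj
      -- Both `e` and the death chain of `y` contain the new simplex, so their sum is an old chain.
      -- This gives a relation at `k` with coefficient `1` on `y`, which independence forbids.
      · have := ih (Function.update a y 1) (by
          rw [hsum', one_smul, hyd.2.2, ← hee, ← map_add]
          exact mem_boundaries.2 ⟨_, ha.add_mem_chains (hyq ▸ hyd.1) he hyd.2.1 hes, rfl⟩) y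
          (hya ▸ Finset.mem_insert_self _ _)
        rw [Function.update_self] at this
        exact absurd this one_ne_zero
    · have heq : active X (k + 1) q = active X k q := by
        refine le_antisymm hsub fun j hj => ?_
        rw [mem_active] at hj ⊢
        have : (X j).death ≠ k := fun h => hyq (huniq j h ▸ hj.1)
        omega
      rw [ha.boundaries_eq_of_card_ne (by omega), heq] at h2
      rw [heq]
      exact ih a h2

/-- At a birth, the newborn cycle bounds in the larger complex at `k`, so a relation moved there
involves the older members only and their coefficients vanish; then the newborn cycle alone would
bound. At a death, a relation at `k + 1` is one at `k` extended by zero. -/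
theorem IndepAt.succ_of_not_fwd (hX : IsRepFamily F X) (hk : k < F.len) (hf : ¬ F.fwd k) {q : ℕ}
    (ih : IndepAt F X k q) : IndepAt F X (k + 1) q := by
  have ha := F.isAddition_of_not_fwd hk hf
  intro a hsum
  rcases hX.events_not_fwd hk hf with ⟨hp, ⟨y, hy, huniq⟩, hd⟩ | ⟨hp, ⟨y, hy, huniq⟩, hb⟩
  · have hsub : active X k q ⊆ active X (k + 1) q := by
      intro j hj
      rw [mem_active] at hj ⊢
      have := hd j
      omega
    have hnew : ∀ j ∈ active X (k + 1) q \ active X k q, j = y := by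
      intro j hj
      rw [Finset.mem_sdiff, mem_active, mem_active] at hj
      exact huniq j (by omega)
    have hsplit := Finset.sum_sdiff (f := fun j => a j • (X j).z (k + 1)) hsub
    have h1 : ∑ j ∈ active X k q, a j • (X j).z (k + 1) ∈ boundaries (F.cx k) q := by
      rw [← hsplit] at hsum
      refine (Submodule.add_mem_iff_right _ ?_).1 (boundaries_mono ha.le q hsum)
      refine Submodule.sum_mem _ fun j hj => Submodule.smul_mem _ _ ?_
      have hyb := (hX.isRep j).birth_of_not_fwd (hnew j hj ▸ hy) hf
      rw [Finset.mem_sdiff, mem_active] at hj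
      rw [hj.1.1] at hyb
      exact mem_boundaries.2 ⟨_, hyb.1, hyb.2.2.symm⟩
    have h2 := sum_mem_of_sum_succ_mem (fun j hj => by
      have hj' := hsub hj
      rw [mem_active] at hj hj'
      exact hj.1 ▸ (hX.isRep j).add_mem_boundaries_of_not_fwd hj.2.1 hj'.2.2 hf) h1
    have h3 := ih a h2
    intro j hj
    by_cases hj' : j ∈ active X k q
    · exact h3 j hj'
    · have hyb := (hX.isRep j).birth_of_not_fwd
        (hnew j (Finset.mem_sdiff.2 ⟨hj, hj'⟩) ▸ hy) hf
      rw [Finset.sum_eq_single j (fun l hl hlj => ?_) (fun h => absurd hj h)] at hsum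
      · by_contra h0
        rw [zmod2_eq_one_of_ne_zero h0, one_smul, hyb.2.2] at hsum
        obtain ⟨e, he, hee⟩ := mem_boundaries.1 hsum
        rw [mem_active] at hj
        rw [hj.1] at hyb
        -- If the newborn cycle were the boundary of `e` after the deletion, its birth chain plus
        -- `e` would be a cycle through the deleted simplex.
        refine hp ⟨q + 1, (X j).c k + e, mem_cycles.2 ⟨add_mem hyb.1 (chains_mono ha.le _ he), ?_⟩,
          ?_⟩
        · rw [map_add, hee, zmod2_add_self]
        · rw [Finsupp.add_apply, ha.apply_eq_zero he, add_zero]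
          exact hyb.2.1
      · have hl' : l ∈ active X k q := by
          by_contra h
          exact hlj ((hnew l (Finset.mem_sdiff.2 ⟨hl, h⟩)).trans
            (hnew j (Finset.mem_sdiff.2 ⟨hj, hj'⟩)).symm)
        rw [h3 l hl', zero_smul]
  · have hsub : active X (k + 1) q ⊆ active X k q := by
      intro j hj
      rw [mem_active] at hj ⊢
      have := hb j
      omega
    have h2 := sum_mem_of_sum_succ_mem (fun j hj => by
      have hj' := hsub hj
      rw [mem_active] at hj hj'
      exact hj.1 ▸ (hX.isRep j).add_mem_boundaries_of_not_fwd hj'.2.1 hj.2.2 hf)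
      (boundaries_mono ha.le q hsum)
    have h3 := ih (fun j => if j ∈ active X (k + 1) q then a j else 0) (by
      rw [← Finset.sum_subset hsub fun j _ hj' => by rw [if_neg hj', zero_smul]]
      rwa [Finset.sum_congr rfl fun j hj => by rw [if_pos hj]])
    intro j hj
    have := h3 j (hsub hj)
    rwa [if_pos hj] at this

theorem IsRepFamily.indepAt (hX : IsRepFamily F X) (q : ℕ) : ∀ k ≤ F.len, IndepAt F X k q
  | 0, _ => by
    intro a _ j hj
    have := (hX.isRep j).one_le_birth
    rw [mem_active] at hj
    omega
  | k + 1, hk => by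
    have ih := hX.indepAt q k (by omega)
    by_cases hf : F.fwd k
    · exact ih.succ_of_fwd hX hk hf
    · exact ih.succ_of_not_fwd hX hk hf

/-- The homology classes at `k` of the members of dimension `q`. -/
def IsRepFamily.classMap (hX : IsRepFamily F X) (k q : ℕ) :
    (active X k q → ZMod 2) →ₗ[ZMod 2] Homology (F.cx k) q :=
  (homologyClass (F.cx k) q).comp (Fintype.linearCombination (ZMod 2)
    fun j : active X k q => (⟨(X j.1).z k, by
      have h := mem_active.1 j.2
      have := (hX.isRep j.1).cycle k h.2
      rwa [h.1] at this⟩ : cycles (F.cx k) q))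

theorem IsRepFamily.classMap_apply (hX : IsRepFamily F X) (k q : ℕ)
    (a : active X k q → ZMod 2) :
    ∃ z : cycles (F.cx k) q, hX.classMap k q a = homologyClass _ q z ∧
      (z : Chain V) = ∑ j ∈ (active X k q).attach, a j • (X j.1).z k := by
  refine ⟨_, rfl, ?_⟩
  rw [Fintype.linearCombination_apply, Submodule.coe_sum]
  rfl

theorem IsRepFamily.classMap_injective (hX : IsRepFamily F X) (hk : k ≤ F.len) (q : ℕ) :
    Function.Injective (hX.classMap k q) := by
  rw [injective_iff_map_eq_zero]
  intro a h0
  obtain ⟨z, hz, hz'⟩ := hX.classMap_apply k q a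
  rw [hz, homologyClass_eq_zero, hz'] at h0
  have h1 := hX.indepAt q k hk (fun j => if h : j ∈ active X k q then a ⟨j, h⟩ else 0) (by
    rw [← Finset.sum_attach]
    convert h0 using 3 with j
    rw [dif_pos j.2])
  funext j
  simpa using h1 j.1 j.2

/-- Independent classes in the number of the Betti number span. -/
theorem IsRepFamily.classMap_surjective (hX : IsRepFamily F X) (hk : k ≤ F.len) (q : ℕ) :
    Function.Surjective (hX.classMap k q) := by
  have := finite_homology (F.finite_faces k hk) q
  refine (LinearMap.injective_iff_surjective_of_finrank_eq_finrank ?_).1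
    (hX.classMap_injective hk q)
  rw [Module.finrank_fintype_fun_eq_card, Fintype.card_coe, hX.card_active k hk q]
  rfl

theorem IsRepFamily.exists_sum (hX : IsRepFamily F X) (hk : k ≤ F.len) {q : ℕ} {z : Chain V}
    (hz : z ∈ cycles (F.cx k) q) :
    ∃ a : active X k q → ZMod 2,
      z + ∑ j ∈ (active X k q).attach, a j • (X j.1).z k ∈ boundaries (F.cx k) q := by
  obtain ⟨a, ha⟩ := hX.classMap_surjective hk q (homologyClass _ q ⟨z, hz⟩)
  obtain ⟨y, hy, hy'⟩ := hX.classMap_apply k q a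
  rw [hy, homologyClass_eq, hy', add_comm] at ha
  exact ⟨a, ha⟩

end Events

end Family

/-! ### Barcodes with representatives as families with prescribed cardinalities -/

/-- Equal multiplicities mean fibres of equal size, which can be matched one by one. -/
theorem exists_equiv_of_map_univ_eq {α β γ : Type*} [Fintype α] [Fintype β] {f : α → γ} {g : β → γ}
    (h : (Finset.univ : Finset α).val.map f = (Finset.univ : Finset β).val.map g) :
    ∃ e : α ≃ β, ∀ a, g (e a) = f a := by
  have key : ∀ c, Nonempty ({a // f a = c} ≃ {b // g b = c}) := by
    intro c
    rw [← Fintype.card_eq, Fintype.card_subtype, Fintype.card_subtype]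
    have := congrArg (Multiset.count c) h
    rw [Multiset.count_map, Multiset.count_map] at this
    simp only [Finset.card, Finset.filter_val]
    simpa only [eq_comm (a := c)] using this
  exact ⟨Equiv.ofFiberEquiv fun c => (key c).some, fun a => Equiv.ofFiberEquiv_map _ a⟩

/-- The members of a multiset as a family. -/
def elt {α : Type*} [DecidableEq α] (D : Multiset α) (j : D) : α := j.1

theorem map_univ_elt {α : Type*} [DecidableEq α] (D : Multiset α) :
    (Finset.univ : Finset D).val.map (elt D) = D := D.map_univ_coe

theorem elt_mem {α : Type*} [DecidableEq α] (D : Multiset α) (j : D) : elt D j ∈ D := Multiset.coe_mem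

theorem exists_elt_eq {α : Type*} [DecidableEq α] {D : Multiset α} {x : α} (hx : x ∈ D) : ∃ j, elt D j = x := by
  rw [← map_univ_elt D] at hx
  obtain ⟨j, -, hj⟩ := Multiset.mem_map.1 hx
  exact ⟨j, hj⟩

theorem sum_elt {α : Type*} [DecidableEq α] (B : Multiset α) (f : α → ℕ) :
    ∑ j, f (elt B j) = (B.map f).sum := by
  conv_rhs => rw [← map_univ_elt B, Multiset.map_map]
  rfl

theorem sum_map_ite {α : Type*} (B : Multiset α) (P : α → Prop) [DecidablePred P] :
    (B.map fun x => if P x then 1 else 0).sum = B.countP P := by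
  induction B using Multiset.induction with
  | empty => rfl
  | cons a B ih =>
    rw [Multiset.map_cons, Multiset.sum_cons, ih, Multiset.countP_cons, add_comm]

namespace ZigzagModule

theorem finrank_plift (P : Prop) [Decidable P] :
    Module.finrank (ZMod 2) (PLift P → ZMod 2) = if P then 1 else 0 := by
  rw [Module.finrank_fintype_fun_eq_card]
  split_ifs with h
  · have : Unique (PLift P) := ⟨⟨⟨h⟩⟩, fun _ => rfl⟩
    exact Fintype.card_unique
  · have : IsEmpty (PLift P) := ⟨fun x => h x.down⟩
    exact Fintype.card_eq_zero

variable {m : ℕ} {fwd : ℕ → Prop}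

/-- The sum of the interval modules over a family of intervals. -/
abbrev intervalSum (m : ℕ) (fwd : ℕ → Prop) {J : Type} (I : J → ℕ × ℕ) : ZigzagModule.{0} m fwd :=
  directSum fun j => interval m fwd (I j).1 (I j).2

theorem finrank_intervalSum {J : Type} [Fintype J] (I : J → ℕ × ℕ) (k : ℕ) :
    Module.finrank (ZMod 2) ((intervalSum m fwd I).space k) =
      ∑ j, if (I j).1 ≤ k ∧ k ≤ (I j).2 then 1 else 0 := by
  have : Module.finrank (ZMod 2) (⨁ j, (PLift ((I j).1 ≤ k ∧ k ≤ (I j).2) → ZMod 2)) =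
      ∑ j, if (I j).1 ≤ k ∧ k ≤ (I j).2 then 1 else 0 := by
    rw [Module.finrank_directSum]
    exact Finset.sum_congr rfl fun j _ => finrank_plift _
  exact this

theorem finite_intervalSum {J : Type} [Fintype J] (I : J → ℕ × ℕ) (k : ℕ) :
    Module.Finite (ZMod 2) ((intervalSum m fwd I).space k) :=
  inferInstanceAs
    (Module.Finite (ZMod 2) (⨁ j, (PLift ((I j).1 ≤ k ∧ k ≤ (I j).2) → ZMod 2)))

end ZigzagModule

open ZigzagModule

/-! ### The isomorphism between homology and the sum of interval modules -/

section

variable {ι : Type*} [Fintype ι] {F : Filtration V} {X : ι → Bar V} {q : ℕ}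
  {J : Type} {I : J → ℕ × ℕ}

/-- The members of dimension `q`. -/
abbrev ofDim (X : ι → Bar V) (q : ℕ) : Finset ι := Finset.univ.filter fun j => (X j).dim = q

/-- Coordinates of the sum of interval modules at `k`, indexed by the intervals through `k`. -/
def coords (m : ℕ) (fwd : ℕ → Prop) (e : J ≃ ofDim X q)
    (he : ∀ j, ((X (e j).1).birth, (X (e j).1).death) = I j) (k : ℕ) :
    (intervalSum m fwd I).space k →ₗ[ZMod 2] (active X k q → ZMod 2) :=
  LinearMap.pi fun l =>
    (LinearMap.proj ⟨by
      have h := mem_active.1 l.2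
      have h' := he (e.symm ⟨l.1, by simpa using h.1⟩)
      rw [Equiv.apply_symm_apply] at h'
      rw [← h']
      exact h.2⟩).comp
    (DirectSum.component (ZMod 2) J (fun j => (PLift ((I j).1 ≤ k ∧ k ≤ (I j).2) → ZMod 2))
      (e.symm ⟨l.1, by simpa using (mem_active.1 l.2).1⟩))

theorem coords_injective (m : ℕ) (fwd : ℕ → Prop) (e : J ≃ ofDim X q)
    (he : ∀ j, ((X (e j).1).birth, (X (e j).1).death) = I j) (k : ℕ) :
    Function.Injective (coords m fwd e he k) := by
  rw [injective_iff_map_eq_zero]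
  intro x hx
  refine DFinsupp.ext fun j => funext fun ⟨h⟩ => ?_
  have hj := he j
  have hl : (e j).1 ∈ active X k q := by
    refine mem_active.2 ⟨(Finset.mem_filter.1 (e j).2).2, ?_⟩
    rw [← hj] at h
    exact h
  have h0 := congrFun hx ⟨(e j).1, hl⟩
  -- The type of a component depends on its index, and `e.symm (e j)` equals `j` only
  -- propositionally; the index is therefore generalized before substitution.
  have key : ∀ j', j' = j → ∀ h' : PLift ((I j').1 ≤ k ∧ k ≤ (I j').2),
      DirectSum.component (ZMod 2) J (fun j => (PLift ((I j).1 ≤ k ∧ k ≤ (I j).2) → ZMod 2)) j' x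
        h' = 0 →
      DirectSum.component (ZMod 2) J (fun j => (PLift ((I j).1 ≤ k ∧ k ≤ (I j).2) → ZMod 2)) j x
        ⟨h⟩ = 0 := by
    rintro _ rfl ⟨h'⟩ h0
    exact h0
  exact key _ (e.symm_apply_apply j) _ h0

/-- The generator of an interval at `k` with coefficient `f`. -/
abbrev gen {J : Type} {I : J → ℕ × ℕ} (m : ℕ) (fwd : ℕ → Prop) (k : ℕ) (j : J)
    (f : PLift ((I j).1 ≤ k ∧ k ≤ (I j).2) → ZMod 2) : (intervalSum m fwd I).space k :=
  DirectSum.lof (ZMod 2) J (fun j => (PLift ((I j).1 ≤ k ∧ k ≤ (I j).2) → ZMod 2)) j f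

theorem coords_gen (m : ℕ) (fwd : ℕ → Prop) (e : J ≃ ofDim X q)
    (he : ∀ j, ((X (e j).1).birth, (X (e j).1).death) = I j) (k : ℕ) (j : J)
    (f : PLift ((I j).1 ≤ k ∧ k ≤ (I j).2) → ZMod 2) (l : active X k q) :
    coords m fwd e he k (gen (I := I) m fwd k j f) l =
      if h : (e j).1 = l.1 ∧ ((I j).1 ≤ k ∧ k ≤ (I j).2) then f ⟨h.2⟩ else 0 := by
  have hl := mem_active.1 l.2
  have hlq : l.1 ∈ ofDim X q := by simpa using hl.1
  have key : ∀ j', j' = e.symm ⟨l.1, hlq⟩ → ∀ h' : PLift ((I j').1 ≤ k ∧ k ≤ (I j').2),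
      (DirectSum.lof (ZMod 2) J (fun j => (PLift ((I j).1 ≤ k ∧ k ≤ (I j).2) → ZMod 2)) j f) j' h' =
      if h : (e j).1 = l.1 ∧ ((I j).1 ≤ k ∧ k ≤ (I j).2) then f ⟨h.2⟩ else 0 := by
    intro j' hj' h'
    by_cases hjj : j = j'
    · subst hjj
      rw [DirectSum.lof_apply, dif_pos ⟨by rw [hj', Equiv.apply_symm_apply], h'.down⟩]
    · rw [dif_neg]
      · rw [DirectSum.lof_eq_of, DirectSum.of_eq_of_ne _ _ _ (Ne.symm hjj)]
        rfl
      · rintro ⟨h, -⟩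
        apply hjj
        rw [hj', Equiv.eq_symm_apply]
        exact Subtype.ext h
  exact key _ rfl _

/-- With this, compatibility with the arrows can be checked on one generator at a time, at the level
of cycles. -/
theorem exists_classMap_gen (hX : IsRepFamily F X) (m : ℕ) (fwd : ℕ → Prop) (e : J ≃ ofDim X q)
    (he : ∀ j, ((X (e j).1).birth, (X (e j).1).death) = I j) (k : ℕ) (j : J)
    (f : PLift ((I j).1 ≤ k ∧ k ≤ (I j).2) → ZMod 2) :
    ∃ z : cycles (F.cx k) q,
      hX.classMap k q (coords m fwd e he k (gen (I := I) m fwd k j f)) = homologyClass _ q z ∧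
      (z : Chain V) = (if h : (I j).1 ≤ k ∧ k ≤ (I j).2 then f ⟨h⟩ else 0) • (X (e j).1).z k := by
  obtain ⟨z, hz, hz'⟩ := hX.classMap_apply k q (coords m fwd e he k (gen (I := I) m fwd k j f))
  refine ⟨z, hz, hz'.trans ?_⟩
  by_cases h : (I j).1 ≤ k ∧ k ≤ (I j).2
  · have hl : (e j).1 ∈ active X k q := by
      refine mem_active.2 ⟨(Finset.mem_filter.1 (e j).2).2, ?_⟩
      rw [← he j] at h
      exact h
    rw [Finset.sum_eq_single ⟨(e j).1, hl⟩, coords_gen, dif_pos ⟨rfl, h⟩, dif_pos h]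
    · intro l _ hne
      rw [coords_gen, dif_neg, zero_smul]
      rintro ⟨h', -⟩
      exact hne (Subtype.ext h'.symm)
    · exact fun h => absurd (Finset.mem_attach _ _) h
  · rw [dif_neg h, zero_smul]
    refine Finset.sum_eq_zero fun l _ => ?_
    rw [coords_gen, dif_neg fun h' => h h'.2, zero_smul]

theorem intervalSum_right_gen {m : ℕ} {fwd : ℕ → Prop} {k : ℕ} (hk : k < m) (hf : fwd k) (j : J)
    (f : PLift ((I j).1 ≤ k ∧ k ≤ (I j).2) → ZMod 2) :
    (intervalSum m fwd I).right k hk hf (gen (I := I) m fwd k j f) =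
      gen (I := I) m fwd (k + 1) j (intervalMap _ _ f) :=
  DirectSum.lmap_lof _ _ _

theorem intervalSum_left_gen {m : ℕ} {fwd : ℕ → Prop} {k : ℕ} (hk : k < m) (hf : ¬ fwd k) (j : J)
    (f : PLift ((I j).1 ≤ k + 1 ∧ k + 1 ≤ (I j).2) → ZMod 2) :
    (intervalSum m fwd I).left k hk hf (gen (I := I) m fwd (k + 1) j f) =
      gen (I := I) m fwd k j (intervalMap _ _ f) :=
  DirectSum.lmap_lof _ _ _

theorem intervalSum_hom_ext {m : ℕ} {fwd : ℕ → Prop} {k : ℕ} {M : Type*} [AddCommGroup M]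
    [Module (ZMod 2) M] {f g : (intervalSum m fwd I).space k →ₗ[ZMod 2] M}
    (h : ∀ j x, f (gen (I := I) m fwd k j x) = g (gen (I := I) m fwd k j x)) : f = g :=
  DirectSum.linearMap_ext (ZMod 2) fun j => LinearMap.ext fun x => h j x

/-- On a generator there are three cases: across the interior of the interval consecutive cycles are
homologous, at its death the cycle becomes a boundary, and elsewhere both sides are zero. -/
theorem classMap_right (hX : IsRepFamily F X) (e : J ≃ ofDim X q)
    (he : ∀ j, ((X (e j).1).birth, (X (e j).1).death) = I j) {k : ℕ} (hk : k < F.len)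
    (hf : F.fwd k) (hle : F.cx k ≤ F.cx (k + 1))
    (x : (intervalSum F.len F.fwd I).space k) :
    homologyMap hle q (hX.classMap k q (coords F.len F.fwd e he k x)) =
      hX.classMap (k + 1) q (coords F.len F.fwd e he (k + 1)
        ((intervalSum F.len F.fwd I).right k hk hf x)) := by
  have : (homologyMap hle q) ∘ₗ (hX.classMap k q) ∘ₗ (coords F.len F.fwd e he k) =
      (hX.classMap (k + 1) q) ∘ₗ (coords F.len F.fwd e he (k + 1)) ∘ₗ
        ((intervalSum F.len F.fwd I).right k hk hf) := by
    refine intervalSum_hom_ext fun j x => ?_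
    rw [LinearMap.comp_apply, LinearMap.comp_apply, LinearMap.comp_apply, LinearMap.comp_apply,
      intervalSum_right_gen]
    obtain ⟨z, hz, hz'⟩ := exists_classMap_gen hX F.len F.fwd e he k j x
    obtain ⟨y, hy, hy'⟩ := exists_classMap_gen hX F.len F.fwd e he (k + 1) j (intervalMap _ _ x)
    rw [hz, hy, homologyMap_homologyClass, homologyClass_eq]
    change (z : Chain V) + (y : Chain V) ∈ _
    rw [hz', hy']
    have hr := hX.isRep (e j).1
    have hq : (X (e j).1).dim = q := (Finset.mem_filter.1 (e j).2).2
    have h1 : (X (e j).1).birth = (I j).1 := congrArg Prod.fst (he j)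
    have h2 : (X (e j).1).death = (I j).2 := congrArg Prod.snd (he j)
    by_cases hP : (I j).1 ≤ k ∧ k ≤ (I j).2
    · by_cases hQ : (I j).1 ≤ k + 1 ∧ k + 1 ≤ (I j).2
      · have hi : intervalMap ((I j).1 ≤ k ∧ k ≤ (I j).2) ((I j).1 ≤ k + 1 ∧ k + 1 ≤ (I j).2) x ⟨hQ⟩ =
            x ⟨hP⟩ := dif_pos hP
        rw [dif_pos hP, dif_pos hQ, hi, ← smul_add]
        refine Submodule.smul_mem _ _ ?_
        have := hr.add_mem_boundaries_of_fwd (k := k) (by omega) (by omega) hf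
        rwa [hq] at this
      · rw [dif_pos hP, dif_neg hQ, zero_smul, add_zero]
        refine Submodule.smul_mem _ _ ?_
        have := hr.death_of_fwd (k := k) (by omega) hf
        rw [hq] at this
        exact mem_boundaries.2 ⟨_, this.1, this.2.2.symm⟩
    · rw [dif_neg hP, zero_smul, zero_add]
      split_ifs with hQ
      · have hi : intervalMap ((I j).1 ≤ k ∧ k ≤ (I j).2) ((I j).1 ≤ k + 1 ∧ k + 1 ≤ (I j).2) x ⟨hQ⟩ =
            0 := dif_neg hP
        rw [hi, zero_smul]
        exact zero_mem _
      · rw [zero_smul]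
        exact zero_mem _
  exact LinearMap.congr_fun this x

/-- The mirror image: along a backward arrow it is the birth condition that makes the cycle bound.
-/
theorem classMap_left (hX : IsRepFamily F X) (e : J ≃ ofDim X q)
    (he : ∀ j, ((X (e j).1).birth, (X (e j).1).death) = I j) {k : ℕ} (hk : k < F.len)
    (hf : ¬ F.fwd k) (x : (intervalSum F.len F.fwd I).space (k + 1)) :
    homologyMap (F.le_of_not_fwd hk hf) q
        (hX.classMap (k + 1) q (coords F.len F.fwd e he (k + 1) x)) =
      hX.classMap k q (coords F.len F.fwd e he k
        ((intervalSum F.len F.fwd I).left k hk hf x)) := by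
  have : (homologyMap (F.le_of_not_fwd hk hf) q) ∘ₗ (hX.classMap (k + 1) q) ∘ₗ
        (coords F.len F.fwd e he (k + 1)) =
      (hX.classMap k q) ∘ₗ (coords F.len F.fwd e he k) ∘ₗ
        ((intervalSum F.len F.fwd I).left k hk hf) := by
    refine intervalSum_hom_ext fun j x => ?_
    rw [LinearMap.comp_apply, LinearMap.comp_apply, LinearMap.comp_apply, LinearMap.comp_apply,
      intervalSum_left_gen]
    obtain ⟨z, hz, hz'⟩ := exists_classMap_gen hX F.len F.fwd e he (k + 1) j x
    obtain ⟨y, hy, hy'⟩ := exists_classMap_gen hX F.len F.fwd e he k j (intervalMap _ _ x)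
    rw [hz, hy, homologyMap_homologyClass, homologyClass_eq]
    change (z : Chain V) + (y : Chain V) ∈ _
    rw [hz', hy']
    have hr := hX.isRep (e j).1
    have hq : (X (e j).1).dim = q := (Finset.mem_filter.1 (e j).2).2
    have h1 : (X (e j).1).birth = (I j).1 := congrArg Prod.fst (he j)
    have h2 : (X (e j).1).death = (I j).2 := congrArg Prod.snd (he j)
    by_cases hP : (I j).1 ≤ k + 1 ∧ k + 1 ≤ (I j).2
    · by_cases hQ : (I j).1 ≤ k ∧ k ≤ (I j).2
      · have hi : intervalMap ((I j).1 ≤ k + 1 ∧ k + 1 ≤ (I j).2) ((I j).1 ≤ k ∧ k ≤ (I j).2) x ⟨hQ⟩ =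
            x ⟨hP⟩ := dif_pos hP
        rw [dif_pos hP, dif_pos hQ, hi, ← smul_add, add_comm ((X _).z (k + 1))]
        refine Submodule.smul_mem _ _ ?_
        have := hr.add_mem_boundaries_of_not_fwd (k := k) (by omega) (by omega) hf
        rwa [hq] at this
      · rw [dif_pos hP, dif_neg hQ, zero_smul, add_zero]
        refine Submodule.smul_mem _ _ ?_
        have := hr.birth_of_not_fwd (k := k) (by omega) hf
        rw [hq] at this
        exact mem_boundaries.2 ⟨_, this.1, this.2.2.symm⟩
    · rw [dif_neg hP, zero_smul, zero_add]
      split_ifs with hQ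
      · have hi : intervalMap ((I j).1 ≤ k + 1 ∧ k + 1 ≤ (I j).2) ((I j).1 ≤ k ∧ k ≤ (I j).2) x ⟨hQ⟩ =
            0 := dif_neg hP
        rw [hi, zero_smul]
        exact zero_mem _
      · rw [zero_smul]
        exact zero_mem _
  exact LinearMap.congr_fun this x

/-- The classes of the representatives give an isomorphism from the sum of the interval modules. -/
theorem IsRepFamily.nonempty_iso [Fintype J] (hX : IsRepFamily F X) (e : J ≃ ofDim X q)
    (he : ∀ j, ((X (e j).1).birth, (X (e j).1).death) = I j)
    (hB : ∀ k, (∑ j, if (I j).1 ≤ k ∧ k ≤ (I j).2 then 1 else 0) = (active X k q).card) :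
    Nonempty (Iso (F.homology q) (intervalSum F.len F.fwd I)) := by
  have hinj : ∀ k, k ≤ F.len → Function.Injective
      ((hX.classMap k q) ∘ₗ (coords F.len F.fwd e he k)) := fun k hk =>
    (hX.classMap_injective hk q).comp (coords_injective F.len F.fwd e he k)
  have hrank : ∀ k, k ≤ F.len → Module.finrank (ZMod 2) ((intervalSum F.len F.fwd I).space k) =
      Module.finrank (ZMod 2) (Homology (F.cx k) q) := fun k hk => by
    rw [finrank_intervalSum, hB, hX.card_active k hk q]
    rfl
  let E : ∀ k, k ≤ F.len → ((intervalSum F.len F.fwd I).space k ≃ₗ[ZMod 2] Homology (F.cx k) q) :=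
    fun k hk =>
      have := finite_homology (F.finite_faces k hk) q
      have : Module.Finite (ZMod 2) ((intervalSum F.len F.fwd I).space k) := finite_intervalSum I k
      LinearMap.linearEquivOfInjective _ (hinj k hk) (hrank k hk)
  have hE : ∀ k hk x, E k hk x = hX.classMap k q (coords F.len F.fwd e he k x) :=
    fun k hk x => rfl
  refine ⟨⟨fun k hk => (E k hk).symm, fun k hk hf x => ?_, fun k hk hf x => ?_⟩⟩
  · have key : ∀ x : Homology (F.cx k) q, (E (k + 1) hk).symm (homologyMap hf q x) =
        (intervalSum F.len F.fwd I).right k hk hf ((E k hk.le).symm x) := by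
      intro x
      obtain ⟨y, rfl⟩ := (E k hk.le).surjective x
      rw [LinearEquiv.symm_apply_apply, LinearEquiv.symm_apply_eq, hE k hk.le, hE (k + 1) hk]
      exact classMap_right hX e he hk hf hf y
    exact key x
  · have key : ∀ x : Homology (F.cx (k + 1)) q,
        (E k hk.le).symm (homologyMap (F.le_of_not_fwd hk hf) q x) =
        (intervalSum F.len F.fwd I).left k hk hf ((E (k + 1) hk).symm x) := by
      intro x
      obtain ⟨y, rfl⟩ := (E (k + 1) hk).surjective x
      rw [LinearEquiv.symm_apply_apply, LinearEquiv.symm_apply_eq, hE (k + 1) hk, hE k hk.le]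
      exact classMap_left hX e he hk hf y
    exact key x

end

/-- The number of intervals of dimension `q` in `D` that contain `k`. -/
def passing (D : Multiset (Bar V)) (k q : ℕ) : ℕ := D.countP fun x => x.dim = q ∧ x.Contains k

theorem countP_elt {α : Type*} [DecidableEq α] (D : Multiset α) (P : α → Prop)
    [DecidablePred P] :
    (Finset.univ.filter fun j => P (elt D j)).card = D.countP P := by
  conv_rhs => rw [← map_univ_elt D]
  rw [Multiset.countP_map]
  rfl

theorem card_active_elt (D : Multiset (Bar V)) (k q : ℕ) :
    (active (elt D) k q).card = passing D k q := by
  exact countP_elt D fun x => x.dim = q ∧ x.Contains k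

theorem countP_intervals (D : Multiset (Bar V)) (k q : ℕ) :
    ((D.filter fun x => x.dim = q).map fun x => (x.birth, x.death)).countP
      (fun I => I.1 ≤ k ∧ k ≤ I.2) = passing D k q := by
  rw [Multiset.countP_map, Multiset.filter_filter, passing, Multiset.countP_eq_card_filter]
  congr 1
  exact Multiset.filter_congr fun x _ => and_comm

/-- A decomposition gives the counts by comparing ranks. Conversely, the classes of the
representatives provide the decomposition. -/
theorem isRepBarcode_iff_isRepFamily {F : Filtration V} {D : Multiset (Bar V)} :
    IsRepBarcode F D ↔ IsRepFamily F (elt D) := by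
  have hsum : ∀ k q, (∑ j, if (elt ((D.filter fun x => x.dim = q).map
      fun x => (x.birth, x.death)) j).1 ≤ k ∧ k ≤ (elt ((D.filter fun x => x.dim = q).map
      fun x => (x.birth, x.death)) j).2 then 1 else 0) = passing D k q := by
    intro k q
    rw [sum_elt _ fun I : ℕ × ℕ => if I.1 ≤ k ∧ k ≤ I.2 then 1 else 0, sum_map_ite,
      countP_intervals]
  constructor
  · rintro ⟨h1, h2⟩
    refine ⟨fun j => h1 _ (elt_mem D j), fun k hk q => ?_⟩
    obtain ⟨-, ⟨E⟩⟩ := h2 q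
    rw [card_active_elt, ← hsum, ← finrank_intervalSum (m := F.len) (fwd := F.fwd)]
    exact (E.equiv k hk).finrank_eq.symm
  · intro hX
    have h1 : ∀ x ∈ D, x.IsRep F := by
      intro x hx
      obtain ⟨j, rfl⟩ := exists_elt_eq hx
      exact hX.isRep j
    refine ⟨h1, fun q => ⟨?_, ?_⟩⟩
    · intro I hI
      obtain ⟨x, hx, rfl⟩ := Multiset.mem_map.1 hI
      have hr := h1 x (Multiset.mem_filter.1 hx).1
      exact ⟨hr.birth_le_death, hr.death_lt_len.le⟩
    · obtain ⟨e, he⟩ := exists_equiv_of_map_univ_eq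
        (f := elt ((D.filter fun x => x.dim = q).map fun x => (x.birth, x.death)))
        (g := fun j : ofDim (elt D) q => ((elt D j.1).birth, (elt D j.1).death)) (by
          rw [map_univ_elt, Finset.univ_eq_attach]
          change _ = Multiset.map (fun j : ofDim (elt D) q =>
            ((elt D j.1).birth, (elt D j.1).death)) (Multiset.attach _)
          refine Eq.trans ?_ (Multiset.attach_map_val' _ fun j =>
            ((elt D j).birth, (elt D j).death)).symm
          rw [Finset.filter_val]
          conv_lhs => rw [← map_univ_elt D, Multiset.filter_map, Multiset.map_map]
          rfl)
      exact hX.nonempty_iso e he fun k => (hsum k q).trans (card_active_elt D k q).symm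

/-- The working criterion: a new barcode only needs the validity of each representative and a count
of intervals at each index. -/
theorem isRepBarcode_iff {F : Filtration V} {D : Multiset (Bar V)} :
    IsRepBarcode F D ↔
      (∀ x ∈ D, x.IsRep F) ∧ ∀ k ≤ F.len, ∀ q, passing D k q = betti (F.cx k) q := by
  constructor
  · intro h
    exact ⟨h.1, fun k hk q => (card_active_elt D k q).symm.trans
      ((isRepBarcode_iff_isRepFamily.1 h).card_active k hk q)⟩
  · rintro ⟨h1, h2⟩
    exact isRepBarcode_iff_isRepFamily.2 ⟨fun j => h1 _ (elt_mem D j),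
      fun k hk q => (card_active_elt D k q).trans (h2 k hk q)⟩

/-! ### The two halves of a representative -/

namespace Bar

/-- The conditions on a representative that concern the indices up to `i`. -/
structure LeftRep (F : Filtration V) (i : ℕ) (x : Bar V) : Prop where
  one_le_birth : 1 ≤ x.birth
  birth_le : x.birth ≤ i
  cycle : ∀ k, x.birth ≤ k → k ≤ i → x.z k ∈ cycles (F.cx k) x.dim
  chain : ∀ k, x.birth ≤ k → k < i →
    x.c k ∈ chains (if F.fwd k then F.cx (k + 1) else F.cx k) (x.dim + 1) ∧
      x.z k + x.z (k + 1) = boundary (x.c k)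
  birth_forward : F.fwd (x.birth - 1) → F.sx (x.birth - 1) ∈ (x.z x.birth).support
  birth_backward : ¬ F.fwd (x.birth - 1) →
    x.c (x.birth - 1) ∈ chains (F.cx (x.birth - 1)) (x.dim + 1) ∧
      F.sx (x.birth - 1) ∈ (x.c (x.birth - 1)).support ∧
      x.z x.birth = boundary (x.c (x.birth - 1))

/-- The conditions on a representative that concern the indices from `i` on. -/
structure RightRep (F : Filtration V) (i : ℕ) (x : Bar V) : Prop where
  le_death : i ≤ x.death
  death_lt_len : x.death < F.len
  cycle : ∀ k, i ≤ k → k ≤ x.death → x.z k ∈ cycles (F.cx k) x.dim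
  chain : ∀ k, i ≤ k → k < x.death →
    x.c k ∈ chains (if F.fwd k then F.cx (k + 1) else F.cx k) (x.dim + 1) ∧
      x.z k + x.z (k + 1) = boundary (x.c k)
  death_forward : F.fwd x.death →
    x.c x.death ∈ chains (F.cx (x.death + 1)) (x.dim + 1) ∧
      F.sx x.death ∈ (x.c x.death).support ∧
      x.z x.death = boundary (x.c x.death)
  death_backward : ¬ F.fwd x.death → F.sx x.death ∈ (x.z x.death).support

namespace IsRep

variable {F : Filtration V} {x y w : Bar V} {i : ℕ}

theorem leftRep (hx : x.IsRep F) (hi : x.Contains i) : LeftRep F i x where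
  one_le_birth := hx.one_le_birth
  birth_le := hi.1
  cycle k h1 h2 := hx.cycle k ⟨h1, h2.trans hi.2⟩
  chain k h1 h2 := hx.chain k h1 (h2.trans_le hi.2)
  birth_forward := hx.birth_forward
  birth_backward := hx.birth_backward

theorem rightRep (hx : x.IsRep F) (hi : x.Contains i) : RightRep F i x where
  le_death := hi.2
  death_lt_len := hx.death_lt_len
  cycle k h1 h2 := hx.cycle k ⟨hi.1.trans h1, h2⟩
  chain k h1 h2 := hx.chain k (hi.1.trans h1) h2
  death_forward := hx.death_forward
  death_backward := hx.death_backward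

/-- The gap between `i` and `j` leaves room for the index and the two arrows inserted by the
expansion. -/
theorem of_halves {j : ℕ} (hij : i ≤ j) (hl : LeftRep F i x) (hr : RightRep F j x)
    (hz : ∀ k, i < k → k < j → x.z k ∈ cycles (F.cx k) x.dim)
    (hc : ∀ k, i ≤ k → k < j →
      x.c k ∈ chains (if F.fwd k then F.cx (k + 1) else F.cx k) (x.dim + 1) ∧
        x.z k + x.z (k + 1) = boundary (x.c k)) : x.IsRep F where
  one_le_birth := hl.one_le_birth
  birth_le_death := hl.birth_le.trans (hij.trans hr.le_death)
  death_lt_len := hr.death_lt_len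
  cycle k h := by
    rcases le_or_gt k i with h1 | h1
    · exact hl.cycle k h.1 h1
    · rcases le_or_gt j k with h2 | h2
      · exact hr.cycle k h2 h.2
      · exact hz k h1 h2
  chain k h h' := by
    rcases lt_or_ge k i with h1 | h1
    · exact hl.chain k h h1
    · rcases le_or_gt j k with h2 | h2
      · exact hr.chain k h2 h'
      · exact hc k h1 h2
  birth_forward := hl.birth_forward
  birth_backward := hl.birth_backward
  death_forward := hr.death_forward
  death_backward := hr.death_backward

theorem of_halves_self (hl : LeftRep F i x) (hr : RightRep F i x) : x.IsRep F :=
  of_halves le_rfl hl hr (fun _ _ _ => by omega) (fun _ _ _ => by omega)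

/-! ### Sums of representatives -/

theorem mem_support_add_left {a b : Chain V} {s : Finset V} (ha : a s = 0) (hb : s ∈ b.support) :
    s ∈ (a + b).support := by
  rw [Finsupp.mem_support_iff] at hb ⊢
  rwa [Finsupp.add_apply, ha, zero_add]

/-- If `x` is older, `y` is born at a forward arrow whose simplex `x` avoids, so the sum still
contains it. If `x` is younger, it is born at a backward arrow as the boundary of its birth chain,
and that chain lets its cycles join those of `y`. The bar `w` is arbitrary on the right of `i`, so
that the lemma serves both `addTo` and `link`. -/
theorem leftRep_sum (hx : x.IsRep F) (hy : y.IsRep F) (hd : x.dim = y.dim) (hxi : x.Contains i)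
    (hyi : y.Contains i) (hb : F.precB x.birth y.birth) (hwd : w.dim = y.dim)
    (hwb : w.birth = y.birth) (hwz : w.z = sumZ x y) (hwc : w.c = sumC F x y) :
    LeftRep F i w := by
  obtain ⟨hx1, hx2⟩ := hxi
  obtain ⟨hy1, hy2⟩ := hyi
  have hy0 := hy.one_le_birth
  have hx0 := hx.one_le_birth
  have zy : ∀ k, y.birth ≤ k → k ≤ i → k < x.birth → w.z k = y.z k := fun k h1 h2 h3 => by
    rw [hwz, sumZ, if_neg (fun h => by have := h.1; omega), if_pos ⟨h1, by omega⟩, zero_add]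
  have zxy : ∀ k, y.birth ≤ k → k ≤ i → x.birth ≤ k → w.z k = x.z k + y.z k :=
    fun k h1 h2 h3 => by
      rw [hwz, sumZ, if_pos ⟨h3, by omega⟩, if_pos ⟨h1, by omega⟩]
  have cy : ∀ k, y.HasChain F k → k + 1 < x.birth → w.c k = y.c k := fun k h1 h3 => by
    rw [hwc, sumC, if_neg, if_pos h1, zero_add]
    rintro (h | h | h) <;> omega
  have cxy : ∀ k, y.HasChain F k → x.HasChain F k → w.c k = x.c k + y.c k :=
    fun k h1 h3 => by rw [hwc, sumC, if_pos h3, if_pos h1]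
  rcases hb with ⟨hlt, hf⟩ | ⟨hlt, hf⟩
  · refine ⟨by omega, by omega, fun k h1 h2 => ?_, fun k h1 h2 => ?_, fun _ => ?_,
      fun h => absurd hf (hwb ▸ h)⟩
    · rw [hwb] at h1
      rw [zxy k h1 h2 (by omega), hwd]
      exact add_mem (hd ▸ hx.cycle k ⟨by omega, by omega⟩) (hy.cycle k ⟨h1, by omega⟩)
    · rw [hwb] at h1
      rw [zxy k h1 (by omega) (by omega), zxy (k + 1) (by omega) h2 (by omega),
        cxy k (Or.inl ⟨h1, by omega⟩) (Or.inl ⟨by omega, by omega⟩), hwd]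
      have h3 := hx.chain k (by omega) (by omega)
      have h4 := hy.chain k (by omega) (by omega)
      rw [hd] at h3
      exact ⟨add_mem h3.1 h4.1, by rw [map_add, ← h3.2, ← h4.2]; abel⟩
    · rw [hwb, zxy y.birth le_rfl hy1 hlt.le]
      have h3 := hx.z_succ_apply_of_fwd (k := y.birth - 1)
        (by have := hy.death_lt_len; omega) (by omega) (by omega) hf
      rw [show y.birth - 1 + 1 = y.birth by omega] at h3
      exact mem_support_add_left h3 (hy.birth_forward hf)
  · refine ⟨by omega, by omega, fun k h1 h2 => ?_, fun k h1 h2 => ?_, fun h => ?_, fun h => ?_⟩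
    · rw [hwb] at h1
      rcases lt_or_ge k x.birth with h3 | h3
      · rw [zy k h1 h2 h3, hwd]
        exact hy.cycle k ⟨h1, by omega⟩
      · rw [zxy k h1 h2 h3, hwd]
        exact add_mem (hd ▸ hx.cycle k ⟨by omega, by omega⟩) (hy.cycle k ⟨h1, by omega⟩)
    · rw [hwb] at h1
      have h4 := hy.chain k (by omega) (by omega)
      have hcy : y.HasChain F k := Or.inl ⟨h1, by omega⟩
      rw [hwd]
      rcases lt_trichotomy (k + 1) x.birth with h3 | h3 | h3
      · rw [zy k h1 (by omega) (by omega), zy (k + 1) (by omega) h2 h3, cy k hcy h3]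
        exact h4
      -- The arrow at which `x` joins: its birth chain accounts for the summand present at `k + 1`
      -- only.
      · have hkx : x.birth - 1 = k := by omega
        rw [hkx] at hf
        have h5 := hx.birth_of_not_fwd h3.symm hf
        rw [zy k h1 (by omega) (by omega), zxy (k + 1) (by omega) h2 (by omega),
          cxy k hcy (Or.inr (Or.inl ⟨h3, hf⟩))]
        rw [if_neg hf] at h4 ⊢
        rw [hd] at h5
        exact ⟨add_mem h5.1 h4.1, by rw [map_add, ← h5.2.2, ← h4.2]; abel⟩
      · rw [zxy k h1 (by omega) (by omega), zxy (k + 1) (by omega) h2 (by omega),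
          cxy k hcy (Or.inl ⟨by omega, by omega⟩)]
        have h3 := hx.chain k (by omega) (by omega)
        rw [hd] at h3
        exact ⟨add_mem h3.1 h4.1, by rw [map_add, ← h3.2, ← h4.2]; abel⟩
    · rw [hwb] at h ⊢
      rw [zy _ le_rfl hy1 hlt]
      exact hy.birth_forward h
    · rw [hwb] at h ⊢
      rw [hwd, zy _ le_rfl hy1 hlt, cy _ (Or.inr (Or.inl ⟨by omega, h⟩)) (by omega)]
      exact hy.birth_backward h

/-- The mirror image of `leftRep_sum`: either `x` crosses the backward arrow at which `y` dies and
avoids its simplex, or `x` dies earlier at a forward arrow and its death chain lets it leave the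
sum. -/
theorem rightRep_sum (hx : x.IsRep F) (hy : y.IsRep F) (hd : x.dim = y.dim) (hxi : x.Contains i)
    (hyi : y.Contains i) (hb : F.precD x.death y.death) (hwd : w.dim = y.dim)
    (hwb : w.death = y.death) (hwz : w.z = sumZ x y) (hwc : w.c = sumC F x y) :
    RightRep F i w := by
  obtain ⟨hx1, hx2⟩ := hxi
  obtain ⟨hy1, hy2⟩ := hyi
  have hyl := hy.death_lt_len
  have zy : ∀ k, i ≤ k → k ≤ y.death → x.death < k → w.z k = y.z k := fun k h1 h2 h3 => by
    rw [hwz, sumZ, if_neg (fun h => by have := h.2; omega), if_pos ⟨by omega, h2⟩, zero_add]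
  have zxy : ∀ k, i ≤ k → k ≤ y.death → k ≤ x.death → w.z k = x.z k + y.z k :=
    fun k h1 h2 h3 => by
      rw [hwz, sumZ, if_pos ⟨by omega, h3⟩, if_pos ⟨by omega, h2⟩]
  have cy : ∀ k, y.HasChain F k → x.death < k → w.c k = y.c k := fun k h1 h3 => by
    rw [hwc, sumC, if_neg, if_pos h1, zero_add]
    rintro (h | h | h) <;> omega
  have cxy : ∀ k, y.HasChain F k → x.HasChain F k → w.c k = x.c k + y.c k :=
    fun k h1 h3 => by rw [hwc, sumC, if_pos h3, if_pos h1]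
  rcases hb with ⟨hlt, hf⟩ | ⟨hlt, hf⟩
  · refine ⟨by omega, by omega, fun k h1 h2 => ?_, fun k h1 h2 => ?_,
      fun h => absurd (hwb ▸ h) hf, fun _ => ?_⟩
    · rw [hwb] at h2
      rw [zxy k h1 h2 (by omega), hwd]
      exact add_mem (hd ▸ hx.cycle k ⟨by omega, by omega⟩) (hy.cycle k ⟨by omega, h2⟩)
    · rw [hwb] at h2
      rw [zxy k h1 (by omega) (by omega), zxy (k + 1) (by omega) h2 (by omega),
        cxy k (Or.inl ⟨by omega, by omega⟩) (Or.inl ⟨by omega, by omega⟩), hwd]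
      have h3 := hx.chain k (by omega) (by omega)
      have h4 := hy.chain k (by omega) (by omega)
      rw [hd] at h3
      exact ⟨add_mem h3.1 h4.1, by rw [map_add, ← h3.2, ← h4.2]; abel⟩
    · rw [hwb, zxy y.death hy2 le_rfl hlt.le]
      exact mem_support_add_left (hx.z_apply_of_not_fwd hyl (by omega) (by omega) hf)
        (hy.death_backward hf)
  · refine ⟨by omega, by omega, fun k h1 h2 => ?_, fun k h1 h2 => ?_, fun h => ?_, fun h => ?_⟩
    · rw [hwb] at h2
      rcases lt_or_ge x.death k with h3 | h3
      · rw [zy k h1 h2 h3, hwd]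
        exact hy.cycle k ⟨by omega, h2⟩
      · rw [zxy k h1 h2 h3, hwd]
        exact add_mem (hd ▸ hx.cycle k ⟨by omega, by omega⟩) (hy.cycle k ⟨by omega, h2⟩)
    · rw [hwb] at h2
      have h4 := hy.chain k (by omega) (by omega)
      have hcy : y.HasChain F k := Or.inl ⟨by omega, h2⟩
      rw [hwd]
      rcases lt_trichotomy x.death k with h3 | h3 | h3
      · rw [zy k h1 (by omega) (by omega), zy (k + 1) (by omega) h2 (by omega), cy k hcy h3]
        exact h4
      · rw [h3] at hf
        have h5 := hx.death_of_fwd h3 hf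
        rw [zxy k h1 (by omega) (by omega), zy (k + 1) (by omega) h2 (by omega),
          cxy k hcy (Or.inr (Or.inr ⟨h3.symm, hf⟩))]
        rw [if_pos hf] at h4 ⊢
        rw [hd] at h5
        exact ⟨add_mem h5.1 h4.1, by rw [map_add, ← h5.2.2, ← h4.2]; abel⟩
      · rw [zxy k h1 (by omega) (by omega), zxy (k + 1) (by omega) h2 (by omega),
          cxy k hcy (Or.inl ⟨by omega, by omega⟩)]
        have h3 := hx.chain k (by omega) (by omega)
        rw [hd] at h3
        exact ⟨add_mem h3.1 h4.1, by rw [map_add, ← h3.2, ← h4.2]; abel⟩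
    · rw [hwb] at h ⊢
      rw [hwd, zy _ hy2 le_rfl hlt, cy _ (Or.inr (Or.inr ⟨rfl, h⟩)) hlt]
      exact hy.death_forward h
    · rw [hwb] at h ⊢
      rw [zy _ hy2 le_rfl hlt]
      exact hy.death_backward h

theorem sumZ_comm (x y : Bar V) : sumZ x y = sumZ y x := funext fun _ => add_comm _ _

theorem sumC_comm (F : Filtration V) (x y : Bar V) : sumC F x y = sumC F y x :=
  funext fun _ => add_comm _ _

theorem addTo (hx : x.IsRep F) (hy : y.IsRep F) (hd : x.dim = y.dim) (hxi : x.Contains i)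
    (hyi : y.Contains i) (h : Prec F x y) : (addTo F x y).IsRep F :=
  of_halves_self (leftRep_sum hx hy hd hxi hyi h.1 rfl rfl rfl rfl)
    (rightRep_sum hx hy hd hxi hyi h.2 rfl rfl rfl rfl)

/-- The sum is symmetric, so each end may be decided separately: `y` prevails on the left and `x` on
the right. -/
theorem sumBar (hx : x.IsRep F) (hy : y.IsRep F) (hd : x.dim = y.dim) (hxi : x.Contains i)
    (hyi : y.Contains i) (hb : F.precB x.birth y.birth) (hdd : F.precD y.death x.death) :
    (⟨x.dim, y.birth, x.death, sumZ x y, sumC F x y⟩ : Bar V).IsRep F :=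
  of_halves_self (leftRep_sum hx hy hd hxi hyi hb hd rfl rfl rfl)
    (rightRep_sum hy hx hd.symm hyi hxi hdd rfl rfl (sumZ_comm x y) (sumC_comm F x y))

end IsRep

end Bar

/-! ### The expanded filtration -/

namespace Filtration

variable {F : Filtration V} {i : ℕ} {hi : i ≤ F.len} {s : Finset V} {hs : s ∈ F.cx i}
  {hc : ∀ t ∈ F.cx i, s ⊆ t → t = s} {k : ℕ}

theorem expand_len : (F.expand i hi s hs hc).len = F.len + 2 := rfl

theorem expand_cx_of_le (h : k ≤ i) : (F.expand i hi s hs hc).cx k = F.cx k := if_pos h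

theorem expand_cx_mid : (F.expand i hi s hs hc).cx (i + 1) = removeSimplex (F.cx i) s hc :=
  (if_neg (by omega)).trans (if_pos rfl)

theorem expand_cx_add_two (h : i ≤ k) : (F.expand i hi s hs hc).cx (k + 2) = F.cx k :=
  (if_neg (by omega)).trans (if_neg (by omega))

theorem expand_sx_of_lt (h : k < i) : (F.expand i hi s hs hc).sx k = F.sx k := if_pos h

theorem expand_sx_mid : (F.expand i hi s hs hc).sx i = s :=
  (if_neg (by omega)).trans (if_pos (by omega))

theorem expand_sx_mid_succ : (F.expand i hi s hs hc).sx (i + 1) = s :=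
  (if_neg (by omega)).trans (if_pos le_rfl)

theorem expand_sx_add_two (h : i ≤ k) : (F.expand i hi s hs hc).sx (k + 2) = F.sx k :=
  (if_neg (by omega)).trans (if_neg (by omega))

theorem expand_fwd_of_lt (h : k < i) : (F.expand i hi s hs hc).fwd k ↔ F.fwd k := by
  rw [fwd, fwd, expand_cx_of_le h.le, expand_cx_of_le h]

theorem expand_not_fwd_mid : ¬ (F.expand i hi s hs hc).fwd i := by
  rw [fwd, expand_cx_of_le le_rfl, expand_cx_mid]
  exact (isAddition_removeSimplex (F.cx i) s hc hs).not_le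

theorem expand_fwd_mid_succ : (F.expand i hi s hs hc).fwd (i + 1) := by
  rw [fwd, expand_cx_mid, show i + 1 + 1 = i + 2 from rfl, expand_cx_add_two le_rfl]
  exact removeSimplex_le _ _ _

theorem expand_fwd_add_two (h : i ≤ k) : (F.expand i hi s hs hc).fwd (k + 2) ↔ F.fwd k := by
  rw [fwd, fwd, expand_cx_add_two h, show k + 2 + 1 = k + 1 + 2 by omega,
    expand_cx_add_two (by omega)]

theorem expand_ite_of_lt (h : k < i) :
    (if (F.expand i hi s hs hc).fwd k then (F.expand i hi s hs hc).cx (k + 1)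
      else (F.expand i hi s hs hc).cx k) = if F.fwd k then F.cx (k + 1) else F.cx k := by
  simp only [expand_fwd_of_lt h, expand_cx_of_le h.le, expand_cx_of_le (show k + 1 ≤ i from h)]

theorem expand_ite_add_two (h : i ≤ k) :
    (if (F.expand i hi s hs hc).fwd (k + 2) then (F.expand i hi s hs hc).cx (k + 2 + 1)
      else (F.expand i hi s hs hc).cx (k + 2)) = if F.fwd k then F.cx (k + 1) else F.cx k := by
  simp only [expand_fwd_add_two h, expand_cx_add_two h, show k + 2 + 1 = k + 1 + 2 by omega,
    expand_cx_add_two (show i ≤ k + 1 by omega)]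

end Filtration

namespace Bar

open Filtration

variable {F : Filtration V} {i : ℕ} {hi : i ≤ F.len} {s : Finset V} {hs : s ∈ F.cx i}
  {hc : ∀ t ∈ F.cx i, s ⊆ t → t = s} {x w : Bar V}

theorem expandZ_of_le {z : ℕ → Chain V} {k : ℕ} (h : k ≤ i) : expandZ i z k = z k := if_pos h

theorem expandZ_mid {z : ℕ → Chain V} : expandZ i z (i + 1) = z i :=
  (if_neg (by omega)).trans (if_pos rfl)

theorem expandZ_add_two {z : ℕ → Chain V} {k : ℕ} (h : i ≤ k) : expandZ i z (k + 2) = z k :=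
  (if_neg (by omega)).trans (if_neg (by omega))

theorem expandC_of_lt {c : ℕ → Chain V} {k : ℕ} (h : k < i) : expandC i c k = c k := if_pos h

theorem expandC_mid {c : ℕ → Chain V} {k : ℕ} (h : i ≤ k) (h' : k ≤ i + 1) :
    expandC i c k = 0 := (if_neg (by omega)).trans (if_pos h')

theorem expandC_add_two {c : ℕ → Chain V} {k : ℕ} (h : i ≤ k) : expandC i c (k + 2) = c k :=
  (if_neg (by omega)).trans (if_neg (by omega))

theorem LeftRep.expand (hx : LeftRep F i x) (hd : w.dim = x.dim) (hb : w.birth = x.birth)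
    (hz : w.z = expandZ i x.z) (hcc : w.c = expandC i x.c) :
    LeftRep (F.expand i hi s hs hc) i w := by
  have h0 := hx.one_le_birth
  have h1 := hx.birth_le
  refine ⟨by omega, by omega, fun k h2 h3 => ?_, fun k h2 h3 => ?_, fun h => ?_, fun h => ?_⟩
  · rw [hz, hd, expandZ_of_le h3, expand_cx_of_le h3]
    exact hx.cycle k (by omega) h3
  · rw [hz, hd, hcc, expand_ite_of_lt h3, expandZ_of_le h3.le, expandZ_of_le h3,
      expandC_of_lt h3]
    exact hx.chain k (by omega) h3
  · rw [hb] at h ⊢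
    rw [expand_fwd_of_lt (by omega)] at h
    rw [hz, expand_sx_of_lt (by omega), expandZ_of_le h1]
    exact hx.birth_forward h
  · rw [hb] at h ⊢
    rw [expand_fwd_of_lt (by omega)] at h
    rw [hz, hcc, hd, expand_sx_of_lt (by omega), expandZ_of_le h1, expandC_of_lt (by omega),
      expand_cx_of_le (by omega)]
    exact hx.birth_backward h

theorem RightRep.expand (hx : RightRep F i x) (hd : w.dim = x.dim) (hb : w.death = x.death + 2)
    (hz : w.z = expandZ i x.z) (hcc : w.c = expandC i x.c) :
    RightRep (F.expand i hi s hs hc) (i + 2) w := by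
  have h0 := hx.le_death
  have h1 := hx.death_lt_len
  refine ⟨by omega, by rw [expand_len]; omega, fun k h2 h3 => ?_, fun k h2 h3 => ?_, fun h => ?_,
    fun h => ?_⟩
  · obtain ⟨k, rfl⟩ : ∃ l, k = l + 2 := ⟨k - 2, by omega⟩
    rw [hz, hd, expandZ_add_two (by omega), expand_cx_add_two (by omega)]
    exact hx.cycle k (by omega) (by omega)
  · obtain ⟨k, rfl⟩ : ∃ l, k = l + 2 := ⟨k - 2, by omega⟩
    rw [hz, hd, hcc, expand_ite_add_two (by omega), expandZ_add_two (by omega),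
      show k + 2 + 1 = k + 1 + 2 by omega, expandZ_add_two (by omega),
      expandC_add_two (by omega)]
    exact hx.chain k (by omega) (by omega)
  · rw [hb] at h ⊢
    rw [expand_fwd_add_two h0] at h
    rw [hz, hcc, hd, expand_sx_add_two h0, expandZ_add_two h0, expandC_add_two h0,
      show x.death + 2 + 1 = x.death + 1 + 2 by omega, expand_cx_add_two (by omega)]
    exact hx.death_forward h
  · rw [hb] at h ⊢
    rw [expand_fwd_add_two h0] at h
    rw [hz, expand_sx_add_two h0, expandZ_add_two h0]
    exact hx.death_backward h

/-! ### Representatives of the expanded filtration -/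

namespace IsRep

/-- Avoiding `s` at `i` is exactly what lets the same cycle be used in the complex without `s`. -/
theorem carry_of_contains (hx : x.IsRep F) (hxi : x.Contains i) (h0 : x.z i s = 0) :
    (carry i x).IsRep (F.expand i hi s hs hc) := by
  have hb : (carry i x).birth = x.birth := if_pos hxi.1
  have hdd : (carry i x).death = x.death + 2 := if_neg (by have := hxi.2; omega)
  have hcyc : x.z i ∈ cycles (removeSimplex (F.cx i) s hc) x.dim :=
    (isAddition_removeSimplex (F.cx i) s hc hs).mem_cycles_of_apply (hx.cycle i hxi) h0
  refine of_halves (i := i) (j := i + 2) (by omega)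
    ((hx.leftRep hxi).expand rfl hb rfl rfl) ((hx.rightRep hxi).expand rfl hdd rfl rfl)
    (fun k h1 h2 => ?_) (fun k h1 h2 => ?_)
  · obtain rfl : k = i + 1 := by omega
    rw [expand_cx_mid]
    change expandZ i x.z (i + 1) ∈ _
    rw [expandZ_mid]
    exact hcyc
  · change expandC i x.c k ∈ _ ∧ expandZ i x.z k + expandZ i x.z (k + 1) =
      boundary (expandC i x.c k)
    rw [expandC_mid h1 (by omega), map_zero]
    refine ⟨zero_mem _, ?_⟩
    obtain rfl | rfl : k = i ∨ k = i + 1 := by omega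
    · rw [expandZ_of_le le_rfl, expandZ_mid, zmod2_add_self]
    · rw [expandZ_mid, show i + 1 + 1 = i + 2 from rfl, expandZ_add_two le_rfl, zmod2_add_self]

theorem carry_of_death_lt (hx : x.IsRep F) (hd : x.death < i) :
    (carry i x).IsRep (F.expand i hi s hs hc) := by
  have h0 := hx.one_le_birth
  have h1 := hx.birth_le_death
  have h2 := hx.death_lt_len
  have hb : (carry i x).birth = x.birth := if_pos (by omega)
  have hdd : (carry i x).death = x.death := if_pos hd
  have hz : (carry i x).z = expandZ i x.z := rfl
  have hcc : (carry i x).c = expandC i x.c := rfl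
  have hdim : (carry i x).dim = x.dim := rfl
  constructor
  · rwa [hb]
  · rwa [hb, hdd]
  · rw [hdd, expand_len]; omega
  · rintro k ⟨h3, h4⟩
    rw [hz, hdim, expandZ_of_le (by omega), expand_cx_of_le (by omega)]
    exact hx.cycle k ⟨by omega, by omega⟩
  · intro k h3 h4
    rw [hz, hcc, hdim, expand_ite_of_lt (by omega), expandZ_of_le (by omega),
      expandZ_of_le (by omega), expandC_of_lt (by omega)]
    exact hx.chain k (by omega) (by omega)
  · rw [hb, hz, expand_fwd_of_lt (by omega), expand_sx_of_lt (by omega),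
      expandZ_of_le (by omega)]
    exact hx.birth_forward
  · rw [hb, hz, hcc, hdim, expand_fwd_of_lt (by omega), expand_sx_of_lt (by omega),
      expandZ_of_le (by omega), expandC_of_lt (by omega), expand_cx_of_le (by omega)]
    exact hx.birth_backward
  · rw [hdd, hz, hcc, hdim, expand_fwd_of_lt (by omega), expand_sx_of_lt (by omega),
      expandZ_of_le (by omega), expandC_of_lt (by omega), expand_cx_of_le (by omega)]
    exact hx.death_forward
  · rw [hdd, hz, expand_fwd_of_lt (by omega), expand_sx_of_lt (by omega),
      expandZ_of_le (by omega)]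
    exact hx.death_backward

theorem carry_of_lt_birth (hx : x.IsRep F) (hd : i < x.birth) :
    (carry i x).IsRep (F.expand i hi s hs hc) := by
  have h0 := hx.one_le_birth
  have h1 := hx.birth_le_death
  have h2 := hx.death_lt_len
  have hb : (carry i x).birth = x.birth + 2 := if_neg (by omega)
  have hdd : (carry i x).death = x.death + 2 := if_neg (by omega)
  have hz : (carry i x).z = expandZ i x.z := rfl
  have hcc : (carry i x).c = expandC i x.c := rfl
  have hdim : (carry i x).dim = x.dim := rfl
  have hb' : x.birth + 2 - 1 = x.birth - 1 + 2 := by omega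
  constructor
  · omega
  · omega
  · rw [hdd, expand_len]; omega
  · rintro k ⟨h3, h4⟩
    obtain ⟨k, rfl⟩ : ∃ l, k = l + 2 := ⟨k - 2, by omega⟩
    rw [hz, hdim, expandZ_add_two (by omega), expand_cx_add_two (by omega)]
    exact hx.cycle k ⟨by omega, by omega⟩
  · intro k h3 h4
    obtain ⟨k, rfl⟩ : ∃ l, k = l + 2 := ⟨k - 2, by omega⟩
    rw [hz, hcc, hdim, expand_ite_add_two (by omega), expandZ_add_two (by omega),
      show k + 2 + 1 = k + 1 + 2 by omega, expandZ_add_two (by omega),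
      expandC_add_two (by omega)]
    exact hx.chain k (by omega) (by omega)
  · rw [hb, hz, hb', expand_fwd_add_two (by omega), expand_sx_add_two (by omega),
      expandZ_add_two (by omega)]
    exact hx.birth_forward
  · rw [hb, hz, hcc, hdim, hb', expand_fwd_add_two (by omega), expand_sx_add_two (by omega),
      expandZ_add_two (by omega), expandC_add_two (by omega), expand_cx_add_two (by omega)]
    exact hx.birth_backward
  · rw [hdd, hz, hcc, hdim, expand_fwd_add_two (by omega), expand_sx_add_two (by omega),
      expandZ_add_two (by omega), expandC_add_two (by omega),
      show x.death + 2 + 1 = x.death + 1 + 2 by omega, expand_cx_add_two (by omega)]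
    exact hx.death_forward
  · rw [hdd, hz, expand_fwd_add_two (by omega), expand_sx_add_two (by omega),
      expandZ_add_two (by omega)]
    exact hx.death_backward

theorem carry (hx : x.IsRep F) (h0 : x.Contains i → x.z i s = 0) :
    (carry i x).IsRep (F.expand i hi s hs hc) := by
  by_cases h : x.Contains i
  · exact hx.carry_of_contains h (h0 h)
  · rcases lt_or_ge x.death i with h1 | h1
    · exact hx.carry_of_death_lt h1
    · exact hx.carry_of_lt_birth (not_le.1 fun h2 => h ⟨h2, h1⟩)

/-- Arrow `i` of the expansion deletes `s`, so containing `s` is the death condition there. -/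
theorem prefixBar (hx : x.IsRep F) (hxi : x.Contains i) (h1 : s ∈ (x.z i).support) :
    (prefixBar i x).IsRep (F.expand i hi s hs hc) := by
  refine of_halves_self (i := i) ((hx.leftRep hxi).expand rfl rfl rfl rfl)
    ⟨le_rfl, by rw [expand_len]; exact Nat.lt_succ_of_le (Nat.le_succ_of_le hi), fun k h2 h3 => ?_,
      fun k h2 h3 => absurd h3 (not_lt.2 h2), fun h => absurd h expand_not_fwd_mid, fun _ => ?_⟩
  · obtain rfl : k = i := le_antisymm h3 h2
    rw [expand_cx_of_le le_rfl]
    change expandZ k x.z k ∈ _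
    rw [expandZ_of_le le_rfl]
    exact hx.cycle k hxi
  · change Filtration.sx _ i ∈ (expandZ i x.z i).support
    rwa [expand_sx_mid, expandZ_of_le le_rfl]

/-- Arrow `i + 1` of the expansion adds `s`, so containing `s` is the birth condition at `i + 2`. -/
theorem suffixBar (hx : x.IsRep F) (hxi : x.Contains i) (h1 : s ∈ (x.z i).support) :
    (suffixBar i x).IsRep (F.expand i hi s hs hc) := by
  refine of_halves_self (i := i + 2)
    ⟨Nat.le_add_left 1 (i + 1), le_rfl, fun k h2 h3 => ?_,
      fun k h2 h3 => absurd h3 (not_lt.2 h2), fun _ => ?_, fun h => absurd expand_fwd_mid_succ h⟩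
    ((hx.rightRep hxi).expand rfl rfl rfl rfl)
  · obtain rfl : k = i + 2 := le_antisymm h3 h2
    rw [expand_cx_add_two le_rfl]
    change expandZ i x.z (i + 2) ∈ _
    rw [expandZ_add_two le_rfl]
    exact hx.cycle i hxi
  · change Filtration.sx _ (i + 1) ∈ (expandZ i x.z (i + 2)).support
    rwa [expand_sx_mid_succ, expandZ_add_two le_rfl]

/-- The two occurrences of `s` cancel, so the sum survives its removal. -/
theorem link {y : Bar V} (hx : x.IsRep F) (hy : y.IsRep F) (hd : x.dim = y.dim)
    (hxi : x.Contains i) (hyi : y.Contains i) (hb : F.precB x.birth y.birth)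
    (hdd : F.precD y.death x.death) (hxs : s ∈ (x.z i).support) (hys : s ∈ (y.z i).support) :
    (link F i x y).IsRep (F.expand i hi s hs hc) := by
  refine (hx.sumBar hy hd hxi hyi hb hdd).carry fun _ => ?_
  change sumZ x y i s = 0
  rw [Finsupp.mem_support_iff] at hxs hys
  rw [sumZ, if_pos hxi, if_pos hyi, Finsupp.add_apply, zmod2_eq_one_of_ne_zero hxs,
    zmod2_eq_one_of_ne_zero hys]
  rfl

/-- The boundary of `s` bounds on both sides of index `i + 1`, each time by `s` itself. Positivity
of `p` makes the truncated `p - 1` the true dimension. -/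
theorem newBar {p : ℕ} (hp : 1 ≤ p) (hcard : s.card = p + 1) :
    (newBar i p s).IsRep (F.expand i hi s hs hc) := by
  have ha := isAddition_removeSimplex (F.cx i) s hc hs
  have hch : (Finsupp.single s 1 : Chain V) ∈ chains (F.cx i) (p - 1 + 1) :=
    single_mem_chains hs (by omega)
  constructor
  · exact Nat.le_add_left 1 i
  · exact le_rfl
  · change i + 1 < F.len + 2
    omega
  · rintro k ⟨h1, h2⟩
    obtain rfl : k = i + 1 := le_antisymm h2 h1
    rw [expand_cx_mid]
    exact ha.boundary_single_mem (by rw [hcard]; change p + 1 = p - 1 + 2; omega)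
  · intro k h1 h2
    exact absurd h2 (not_lt.2 h1)
  · intro h
    exact absurd h expand_not_fwd_mid
  · intro _
    refine ⟨?_, ?_, rfl⟩
    · change _ ∈ chains (Filtration.cx _ i) _
      rw [expand_cx_of_le le_rfl]
      exact hch
    · change Filtration.sx _ i ∈ _
      rw [expand_sx_mid, Finsupp.mem_support_iff]
      change (Finsupp.single s 1 : Chain V) s ≠ 0
      simp
  · intro _
    refine ⟨?_, ?_, rfl⟩
    · change _ ∈ chains (Filtration.cx _ (i + 2)) _
      rw [expand_cx_add_two le_rfl]
      exact hch
    · change Filtration.sx _ (i + 1) ∈ _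
      rw [expand_sx_mid_succ, Finsupp.mem_support_iff]
      change (Finsupp.single s 1 : Chain V) s ≠ 0
      simp
  · intro h
    exact absurd expand_fwd_mid_succ h

end IsRep

end Bar

/-! ### Consequences of the barcode for births, deaths and touched intervals -/

section

variable {F : Filtration V} {D : Multiset (Bar V)}

theorem IsRepBarcode.nodup_birth (h : IsRepBarcode F D) : (D.map fun x => x.birth).Nodup := by
  rw [← map_univ_elt D, Multiset.map_map]
  exact Finset.univ.nodup.map (isRepBarcode_iff_isRepFamily.1 h).birth_injective

theorem IsRepBarcode.nodup_death (h : IsRepBarcode F D) : (D.map fun x => x.death).Nodup := by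
  rw [← map_univ_elt D, Multiset.map_map]
  exact Finset.univ.nodup.map (isRepBarcode_iff_isRepFamily.1 h).death_injective

theorem IsRepBarcode.card_le (h : IsRepBarcode F D) : D.card ≤ F.len := by
  have h1 : (D.map fun x => x.death) ≤ Multiset.range F.len := by
    rw [Multiset.le_iff_subset h.nodup_death]
    intro d hd
    obtain ⟨x, hx, rfl⟩ := Multiset.mem_map.1 hd
    exact Multiset.mem_range.2 (h.1 x hx).death_lt_len
  simpa using Multiset.card_le_card h1

/-- A cycle through `s` is homologous to a combination of the representatives at `i`. The difference
is a boundary and cannot contain `s`, so one of these representatives must contain it. -/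
theorem touched_ne_zero_iff (h : IsRepBarcode F D) {i p : ℕ} (hi : i ≤ F.len) {s : Finset V}
    (hp : s.card = p + 1) (hc : ∀ t ∈ F.cx i, s ⊆ t → t = s) :
    touched i p s D ≠ 0 ↔ IsAddition.Creates (F.cx i) s := by
  constructor
  · intro hne
    obtain ⟨x, hx⟩ := Multiset.exists_mem_of_ne_zero hne
    obtain ⟨hxD, -, hxi, hxs⟩ := Multiset.mem_filter.1 hx
    exact ⟨x.dim, x.z i, (h.1 x hxD).cycle i hxi, Finsupp.mem_support_iff.1 hxs⟩
  · rintro ⟨q, z, hz, hzs⟩ h0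
    obtain ⟨a, ha⟩ := (isRepBarcode_iff_isRepFamily.1 h).exists_sum hi hz
    obtain ⟨e, he, hee⟩ := mem_boundaries.1 ha
    have h1 := boundary_apply_eq_zero hc he
    have hq : q = p := by
      have := IsAddition.card_of_apply (mem_cycles.1 hz).1 hzs
      omega
    rw [hee, Finsupp.add_apply, Finsupp.finsetSum_apply, Finset.sum_eq_zero, add_zero] at h1
    · exact hzs h1
    · intro j _
      have hj := mem_active.1 j.2
      rw [Finsupp.smul_apply]
      by_contra hne
      have : elt D j.1 ∈ touched i p s D := Multiset.mem_filter.2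
        ⟨elt_mem D j.1, hj.1.trans hq, hj.2,
          Finsupp.mem_support_iff.2 fun h' => hne (by rw [h', smul_zero])⟩
      rw [h0] at this
      exact Multiset.notMem_zero _ this

/-- An untouched representative does not contain the simplex at `i`. -/
theorem apply_eq_zero_of_not_touched {x : Bar V} (hx : x.IsRep F) {i p : ℕ} {s : Finset V}
    (hp : s.card = p + 1) (ht : ¬ x.Touched i p s) (hxi : x.Contains i) : x.z i s = 0 := by
  by_contra hne
  have := IsAddition.card_of_apply (hx.z_mem_chains hxi) hne
  exact ht ⟨by omega, hxi, Finsupp.mem_support_iff.2 hne⟩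

end

/-! ### Counting intervals in the expanded filtration -/

/-- The contribution of one interval to `passing`. -/
def hits (x : Bar V) (k q : ℕ) : ℕ := if x.dim = q ∧ x.Contains k then 1 else 0

theorem hits_eq (x : Bar V) (k q : ℕ) :
    hits x k q = if x.dim = q ∧ x.birth ≤ k ∧ k ≤ x.death then 1 else 0 :=
  if_congr Iff.rfl rfl rfl

theorem passing_cons (x : Bar V) (D : Multiset (Bar V)) (k q : ℕ) :
    passing (x ::ₘ D) k q = passing D k q + hits x k q :=
  Multiset.countP_cons _ _ _

theorem passing_add (D E : Multiset (Bar V)) (k q : ℕ) :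
    passing (D + E) k q = passing D k q + passing E k q := Multiset.countP_add _ _ _

theorem passing_zero (k q : ℕ) : passing (0 : Multiset (Bar V)) k q = 0 := rfl

/-- The index of the original filtration that corresponds to `k`. -/
def oldIndex (i k : ℕ) : ℕ := if k ≤ i then k else if k = i + 1 then i else k - 2

theorem oldIndex_cases (i k : ℕ) :
    (k ≤ i ∧ oldIndex i k = k) ∨ (k = i + 1 ∧ oldIndex i k = i) ∨
      (i + 2 ≤ k ∧ oldIndex i k + 2 = k) := by
  rw [oldIndex]
  split_ifs <;> omega

theorem carry_contains {i k : ℕ} {x : Bar V} :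
    (Bar.carry i x).Contains k ↔ x.Contains (oldIndex i k) := by
  rw [Bar.Contains, Bar.Contains, Bar.carry, oldIndex]
  dsimp only
  split_ifs <;> omega

theorem passing_map_carry (i : ℕ) (D : Multiset (Bar V)) (k q : ℕ) :
    passing (D.map (Bar.carry i)) k q = passing D (oldIndex i k) q := by
  rw [passing, Multiset.countP_map, passing, Multiset.countP_eq_card_filter]
  congr 1
  exact Multiset.filter_congr fun x _ => and_congr Iff.rfl carry_contains

section

variable {F : Filtration V} {i : ℕ} {hi : i ≤ F.len} {s : Finset V} {hs : s ∈ F.cx i}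
  {hc : ∀ t ∈ F.cx i, s ⊆ t → t = s} {k : ℕ}

theorem expand_cx_of_ne (h : k ≠ i + 1) :
    (F.expand i hi s hs hc).cx k = F.cx (oldIndex i k) := by
  rw [oldIndex]
  split_ifs with h1
  · exact Filtration.expand_cx_of_le h1
  · obtain ⟨k, rfl⟩ : ∃ l, k = l + 2 := ⟨k - 2, by omega⟩
    exact Filtration.expand_cx_add_two (by omega)

theorem oldIndex_le (hi : i ≤ F.len) (hk : k ≤ F.len + 2) : oldIndex i k ≤ F.len := by
  rw [oldIndex]
  split_ifs <;> omega

theorem oldIndex_mid : oldIndex i (i + 1) = i := by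
  rw [oldIndex, if_neg (by omega), if_pos rfl]

end

/-! ### Validity and counts of the two outputs -/

theorem exists_of_mem_zipWith_tail {α β : Type*} {R : α → α → Prop} {f : α → α → β} {w : β} :
    ∀ {L : List α}, L.Pairwise R → w ∈ List.zipWith f L L.tail →
      ∃ x ∈ L, ∃ y ∈ L, R x y ∧ w = f x y
  | [], _, h => by simp at h
  | [x], _, h => by simp at h
  | x :: y :: L, hR, h => by
    rw [List.tail_cons, List.zipWith_cons_cons, List.mem_cons] at h
    rcases h with rfl | h
    · exact ⟨x, by simp, y, by simp, (List.pairwise_cons.1 hR).1 y (by simp), rfl⟩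
    · obtain ⟨a, ha, b, hb, h'⟩ := exists_of_mem_zipWith_tail (List.pairwise_cons.1 hR).2 h
      exact ⟨a, List.mem_cons_of_mem _ ha, b, List.mem_cons_of_mem _ hb, h'⟩

theorem hits_link (F : Filtration V) (i k q : ℕ) (x y : Bar V) : hits (Bar.link F i x y) k q =
    if x.dim = q ∧ y.birth ≤ oldIndex i k ∧ oldIndex i k ≤ x.death then 1 else 0 := by
  rw [hits]
  exact if_congr (and_congr Iff.rfl carry_contains) rfl rfl

/-- The links, the prefix and the suffix made of a list of intervals through `i` pass through each
index as often as the list does, except for one missing at `i + 1`. -/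
theorem passing_links (F : Filtration V) (i p k q : ℕ) : ∀ L : List (Bar V), L ≠ [] →
    (∀ x ∈ L, x.dim = p ∧ x.Contains i) →
    passing (List.zipWith (Bar.link F i) L L.tail : Multiset (Bar V)) k q +
      passing ((L.head?.toList.map (Bar.prefixBar i) : List (Bar V)) : Multiset (Bar V)) k q +
      passing ((L.getLast?.toList.map (Bar.suffixBar i) : List (Bar V)) : Multiset (Bar V)) k q +
      (if p = q ∧ k = i + 1 then 1 else 0) = passing (L : Multiset (Bar V)) (oldIndex i k) q
  | [], h, _ => absurd rfl h
  | [x], _, h => by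
    obtain ⟨h1, h2, h3⟩ := h x (by simp)
    have e : ∀ (y : Bar V) (k : ℕ), passing (([y] : List (Bar V)) : Multiset (Bar V)) k q =
        hits y k q := fun y k => by
      rw [← Multiset.cons_coe, passing_cons, Multiset.coe_nil, passing_zero, zero_add]
    simp only [List.tail_cons, List.zipWith_nil_right, List.head?_cons, Option.toList_some,
      List.map_cons, List.map_nil, List.getLast?_singleton, Multiset.coe_nil, passing_zero, e,
      hits_eq, Bar.prefixBar, Bar.suffixBar]
    have ho := oldIndex_cases i k
    generalize oldIndex i k = o at ho ⊢
    split_ifs <;> omega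
  | x :: y :: L, _, h => by
    have ih := passing_links F i p k q (y :: L) (by simp) fun z hz => h z (by simp [hz])
    obtain ⟨h1, h2, h3⟩ := h x (by simp)
    obtain ⟨h4, h5, h6⟩ := h y (by simp)
    rw [List.tail_cons, List.zipWith_cons_cons, List.getLast?_cons_cons, ← Multiset.cons_coe,
      passing_cons, ← Multiset.cons_coe x, passing_cons, ← ih]
    simp only [List.head?_cons, Option.toList_some, List.map_cons, List.map_nil,
      ← Multiset.cons_coe, Multiset.coe_nil, passing_cons, passing_zero, List.tail_cons]
    -- The exchange behind the telescoping: all these intervals meet at `i`, so swapping the left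
    -- ends of `x` and of the prefix of `y` gives the link and the prefix of `x` without changing
    -- how often any index is covered.
    have key : hits (Bar.link F i x y) k q + hits (Bar.prefixBar i x) k q =
        hits (Bar.prefixBar i y) k q + hits x (oldIndex i k) q := by
      rw [hits_link, hits_eq, hits_eq, hits_eq]
      have ho := oldIndex_cases i k
      generalize oldIndex i k = o at ho ⊢
      change (if x.dim = q ∧ y.birth ≤ o ∧ o ≤ x.death then 1 else 0) +
        (if x.dim = q ∧ x.birth ≤ k ∧ k ≤ i then 1 else 0) =
        (if y.dim = q ∧ y.birth ≤ k ∧ k ≤ i then 1 else 0) +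
        if x.dim = q ∧ x.birth ≤ o ∧ o ≤ x.death then 1 else 0
      clear ih
      rw [h1, h4]
      split_ifs <;> omega
    omega

section

variable {F : Filtration V} {i : ℕ} {hi : i ≤ F.len} {s : Finset V} {hs : s ∈ F.cx i}
  {hc : ∀ t ∈ F.cx i, s ⊆ t → t = s} {p : ℕ}

/-- No representative contains `s`, so all carry over; the one extra class at `i + 1` is supplied by
the new interval. -/
theorem isRepBarcode_surjOutput {D : Multiset (Bar V)} (hD : IsRepBarcode F D)
    (hp : s.card = p + 1) (hp1 : 1 ≤ p) (hcr : ¬ IsAddition.Creates (F.cx i) s)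
    (ht : touched i p s D = 0) :
    IsRepBarcode (F.expand i hi s hs hc) (surjOutput i p s D) := by
  rw [isRepBarcode_iff]
  obtain ⟨h1, h2⟩ := isRepBarcode_iff.1 hD
  constructor
  · intro x hx
    rcases Multiset.mem_cons.1 hx with rfl | hx
    · exact Bar.IsRep.newBar hp1 hp
    · obtain ⟨y, hy, rfl⟩ := Multiset.mem_map.1 hx
      refine (h1 y hy).carry (apply_eq_zero_of_not_touched (h1 y hy) hp fun hty => ?_)
      have : y ∈ touched i p s D := Multiset.mem_filter.2 ⟨hy, hty⟩
      rw [ht] at this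
      exact Multiset.notMem_zero _ this
  · intro k hk q
    rw [surjOutput, passing_cons, hits, passing_map_carry, h2 _ (oldIndex_le hi hk)]
    by_cases hki : k = i + 1
    · subst hki
      rw [Filtration.expand_cx_mid, oldIndex_mid,
        (isAddition_removeSimplex (F.cx i) s hc hs).betti_of_not_creates
          ((F.finite_faces i hi).subset (removeSimplex_le _ _ _)) hcr, hp]
      congr 1
      refine if_congr ?_ rfl rfl
      simp only [Bar.newBar, Bar.Contains]
      omega
    · rw [expand_cx_of_ne hki, if_neg, add_zero]
      simp only [Bar.newBar, Bar.Contains]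
      omega

/-- The interval missing at `i + 1` in the count of `passing_links` matches the class lost by
removing `s`. -/
theorem isRepBarcode_injOutput {U : Multiset (Bar V)} {L : List (Bar V)}
    (hD : IsRepBarcode F (U + L)) (hp : s.card = p + 1)
    (hcr : IsAddition.Creates (F.cx i) s) (hU : ∀ x ∈ U, ¬ x.Touched i p s)
    (hL : ∀ x ∈ L, x.Touched i p s) (hne : L ≠ [])
    (hb : L.Pairwise fun x y => F.precB x.birth y.birth)
    (hd : L.Pairwise fun x y => F.precD y.death x.death) :
    IsRepBarcode (F.expand i hi s hs hc) (injOutput F i U L) := by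
  rw [isRepBarcode_iff]
  obtain ⟨h1, h2⟩ := isRepBarcode_iff.1 hD
  have hUr : ∀ x ∈ U, x.IsRep F := fun x hx => h1 x (Multiset.mem_add.2 (Or.inl hx))
  have hLr : ∀ x ∈ L, x.IsRep F := fun x hx => h1 x (Multiset.mem_add.2 (Or.inr hx))
  constructor
  · intro w hw
    simp only [injOutput, Multiset.mem_add, Multiset.mem_map, Multiset.mem_coe, List.mem_map,
      Option.mem_toList] at hw
    rcases hw with ((⟨x, hx, rfl⟩ | hw) | ⟨x, hx, rfl⟩) | ⟨x, hx, rfl⟩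
    · exact (hUr x hx).carry (apply_eq_zero_of_not_touched (hUr x hx) hp (hU x hx))
    · obtain ⟨x, hx, y, hy, ⟨hbb, hdd⟩, rfl⟩ := exists_of_mem_zipWith_tail (hb.and hd) hw
      have hx' := hL x hx
      have hy' := hL y hy
      exact (hLr x hx).link (hLr y hy) (hx'.1.trans hy'.1.symm) hx'.2.1 hy'.2.1 hbb hdd
        hx'.2.2 hy'.2.2
    · have hx' := List.mem_of_mem_head? hx
      exact (hLr x hx').prefixBar (hL x hx').2.1 (hL x hx').2.2
    · have hx' := List.mem_of_mem_getLast? hx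
      exact (hLr x hx').suffixBar (hL x hx').2.1 (hL x hx').2.2
  · intro k hk q
    have h3 := passing_links F i p k q L hne fun x hx => ⟨(hL x hx).1, (hL x hx).2.1⟩
    have h4 := h2 _ (oldIndex_le hi hk) q
    rw [injOutput, passing_add, passing_add, passing_add, passing_map_carry]
    rw [passing_add] at h4
    by_cases hki : k = i + 1
    · subst hki
      have h5 := (isAddition_removeSimplex (F.cx i) s hc hs).betti_of_creates
          ((F.finite_faces i hi).subset (removeSimplex_le _ _ _)) hcr q
      have h6 : (if p = q ∧ i + 1 = i + 1 then 1 else 0) = if s.card = q + 1 then 1 else 0 :=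
        if_congr (by omega) rfl rfl
      rw [Filtration.expand_cx_mid]
      rw [oldIndex_mid] at h3 h4 ⊢
      omega
    · rw [if_neg (by omega)] at h3
      rw [expand_cx_of_ne hki]
      omega

end

/-! ### The reduction -/

theorem not_prec_self (F : Filtration V) (x : Bar V) : ¬ Bar.Prec F x x := by
  rintro ⟨h | h, -⟩ <;> exact lt_irrefl _ h.1

theorem exists_reduces (F : Filtration V) (n : ℕ) (U Λ : Multiset (Bar V)) :
    ∃ t U' Λ', Reduces F n U Λ t U' Λ' := by
  obtain ⟨N, hN⟩ : ∃ N, Λ.card = N := ⟨_, rfl⟩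
  induction N using Nat.strong_induction_on generalizing U Λ with
  | _ N ih =>
    by_cases h : ∀ x ∈ Λ, ∀ y ∈ Λ, ¬ Bar.Prec F x y
    · exact ⟨_, _, _, Reduces.done U Λ h⟩
    · push Not at h
      obtain ⟨x, hx, y, hy, hxy⟩ := h
      obtain ⟨Λ, rfl⟩ := Multiset.exists_cons_of_mem hx
      -- Irreflexivity of `≺` ensures that `y` is still available after one copy of `x` has been
      -- taken out.
      have hy' : y ∈ Λ := (Multiset.mem_cons.1 hy).resolve_left fun h =>
        not_prec_self F x (h ▸ hxy)
      obtain ⟨Λ, rfl⟩ := Multiset.exists_cons_of_mem hy'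
      simp only [Multiset.card_cons] at hN
      obtain ⟨t, U', Λ', hr⟩ := ih (N - 1) (by omega) (Bar.addTo F x y ::ₘ U) (x ::ₘ Λ) (by
        rw [Multiset.card_cons]
        omega)
      exact ⟨_, _, _, Reduces.step U Λ x y hxy t U' Λ' hr⟩

/-- What a run of the reduction preserves. -/
structure ReductionInvariant (F : Filtration V) (i p : ℕ) (s : Finset V)
    (U Λ : Multiset (Bar V)) : Prop where
  barcode : IsRepBarcode F (U + Λ)
  untouched : ∀ x ∈ U, ¬ x.Touched i p s
  touched : ∀ x ∈ Λ, x.Touched i p s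
  ne_zero : Λ ≠ 0

section

variable {F : Filtration V} {i p n t : ℕ} {s : Finset V} {U Λ U' Λ' : Multiset (Bar V)}

theorem not_touched_addTo {x y : Bar V} (hx : x.Touched i p s) (hy : y.Touched i p s) :
    ¬ (Bar.addTo F x y).Touched i p s := by
  rintro ⟨-, -, h⟩
  have h1 : Bar.sumZ x y i s ≠ 0 := Finsupp.mem_support_iff.1 h
  rw [Bar.sumZ, if_pos hx.2.1, if_pos hy.2.1, Finsupp.add_apply,
    zmod2_eq_one_of_ne_zero (Finsupp.mem_support_iff.1 hx.2.2),
    zmod2_eq_one_of_ne_zero (Finsupp.mem_support_iff.1 hy.2.2)] at h1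
  exact h1 rfl

/-- The sum keeps the dimension and the interval of `y`, so no count changes, and it has become
untouched because `s` cancels. -/
theorem ReductionInvariant.step {x y : Bar V} (h : ReductionInvariant F i p s U (x ::ₘ y ::ₘ Λ))
    (hxy : Bar.Prec F x y) :
    ReductionInvariant F i p s (Bar.addTo F x y ::ₘ U) (x ::ₘ Λ) := by
  have hx := h.touched x (by simp)
  have hy := h.touched y (by simp)
  obtain ⟨h1, h2⟩ := isRepBarcode_iff.1 h.barcode
  refine ⟨isRepBarcode_iff.2 ⟨fun w hw => ?_, fun k hk q => ?_⟩, fun w hw => ?_, fun w hw => ?_,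
    Multiset.cons_ne_zero⟩
  · simp only [Multiset.cons_add, Multiset.mem_cons, Multiset.mem_add] at hw
    rcases hw with rfl | hw | rfl | hw
    · exact (h1 x (by simp)).addTo (h1 y (by simp)) (hx.1.trans hy.1.symm) hx.2.1 hy.2.1 hxy
    · exact h1 w (by simp [hw])
    · exact h1 w (by simp)
    · exact h1 w (by simp [hw])
  · rw [← h2 k hk q]
    have e : ∀ E, passing (Bar.addTo F x y ::ₘ E) k q = passing (y ::ₘ E) k q := fun E => by
      rw [passing_cons, passing_cons]
      rfl
    rw [passing_add, e]
    simp only [passing_add, passing_cons]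
    omega
  · rcases Multiset.mem_cons.1 hw with rfl | hw
    · exact not_touched_addTo hx hy
    · exact h.untouched w hw
  · rcases Multiset.mem_cons.1 hw with rfl | hw
    · exact hx
    · exact h.touched w (by simp [hw])

theorem ReductionInvariant.reduces (hr : Reduces F n U Λ t U' Λ')
    (h : ReductionInvariant F i p s U Λ) :
    ReductionInvariant F i p s U' Λ' ∧ ∀ x ∈ Λ', ∀ y ∈ Λ', ¬ Bar.Prec F x y := by
  induction hr with
  | done U Λ h' => exact ⟨h, h'⟩
  | step U Λ x y hxy t U' Λ' hr ih => exact ih (h.step hxy)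

theorem ReductionInvariant.init {D : Multiset (Bar V)} (hD : IsRepBarcode F D)
    (ht : Zigzag.touched i p s D ≠ 0) :
    ReductionInvariant F i p s (Zigzag.untouched i p s D) (Zigzag.touched i p s D) where
  barcode := by
    rw [add_comm, Zigzag.touched, Zigzag.untouched, Multiset.filter_add_not]
    exact hD
  untouched x hx := (Multiset.mem_filter.1 hx).2
  touched x hx := (Multiset.mem_filter.1 hx).2
  ne_zero := ht

end

/-! ### Sorting the remaining intervals -/

/-- A key that sorts birth indices by `≺_b`. -/
def birthKey (F : Filtration V) (b : ℕ) : ℤ := if F.fwd (b - 1) then b else -b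

/-- In the order `≺_b`, births at backward arrows come first, in decreasing order, followed by
births at forward arrows in increasing order; the sign of the key encodes this. -/
theorem precB_of_birthKey_le {F : Filtration V} {b₁ b₂ : ℕ} (h : birthKey F b₁ ≤ birthKey F b₂)
    (hne : b₁ ≠ b₂) : F.precB b₁ b₂ := by
  rw [birthKey, birthKey] at h
  rw [Filtration.precB]
  split_ifs at h with h1 h2 h2
  · exact Or.inl ⟨by omega, h2⟩
  -- A forward birth with key at most that of a backward one forces both indices to be `0`, contrary
  -- to `hne`.
  · omega
  · rcases lt_or_gt_of_ne hne with h3 | h3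
    · exact Or.inl ⟨h3, h2⟩
    · exact Or.inr ⟨h3, h1⟩
  · exact Or.inr ⟨by omega, h1⟩

theorem exists_sorted {F : Filtration V} {Λ : Multiset (Bar V)}
    (h : (Λ.map fun x => x.birth).Nodup) :
    ∃ L : List (Bar V), (L : Multiset (Bar V)) = Λ ∧
      L.Pairwise fun x y => F.precB x.birth y.birth := by
  induction Λ using Quotient.inductionOn with | _ l => ?_
  let r : Bar V → Bar V → Prop := fun x y => birthKey F x.birth ≤ birthKey F y.birth
  have : Std.Total r := ⟨fun x y => le_total _ _⟩
  have : IsTrans (Bar V) r := ⟨fun _ _ _ => le_trans⟩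
  refine ⟨l.insertionSort r, Multiset.coe_eq_coe.2 (List.perm_insertionSort r l), ?_⟩
  have h1 : (l.insertionSort r).Pairwise r := List.pairwise_insertionSort r l
  have h2 : ((l.insertionSort r).map fun x => x.birth).Nodup :=
    ((List.perm_insertionSort r l).map _).nodup_iff.2 (Multiset.coe_nodup.1 h)
  exact (h1.and (List.pairwise_map.1 h2)).imp fun h => precB_of_birthKey_le h.1 h.2

theorem precD_of_not_precD {F : Filtration V} {d₁ d₂ : ℕ} (hne : d₁ ≠ d₂)
    (h : ¬ F.precD d₁ d₂) : F.precD d₂ d₁ := by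
  rw [Filtration.precD] at h ⊢
  rcases lt_or_gt_of_ne hne with h1 | h1
  · exact Or.inl ⟨h1, fun h2 => h (Or.inr ⟨h1, h2⟩)⟩
  · refine Or.inr ⟨h1, ?_⟩
    by_contra h2
    exact h (Or.inl ⟨h1, h2⟩)

/-- Distinct deaths are related one way or the other, and the way that agrees with the births would
make the two intervals comparable. -/
theorem pairwise_precD {F : Filtration V} {L : List (Bar V)}
    (hd : (L.map fun x => x.death).Nodup) (hL : ∀ x ∈ L, ∀ y ∈ L, ¬ Bar.Prec F x y)
    (hb : L.Pairwise fun x y => F.precB x.birth y.birth) :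
    L.Pairwise fun x y => F.precD y.death x.death :=
  (hb.and (List.pairwise_map.1 hd)).imp_of_mem fun hx hy h =>
    precD_of_not_precD h.2 fun h' => hL _ hx _ hy ⟨h.1, h'⟩

/-! ### Bounds on the number of steps -/

/-- The filtration starts empty, so each simplex present was added by an earlier arrow. This bounds
`n` by the length. -/
theorem Filtration.exists_sx_eq (F : Filtration V) {s : Finset V} : ∀ k ≤ F.len, s ∈ F.cx k →
    ∃ j < k, F.sx j = s
  | 0, _, h => by
    rw [F.cx_zero] at h
    exact h.elim
  | k + 1, hk, h => by
    have ih : s ∈ F.cx k → _ := F.exists_sx_eq k (by omega)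
    rcases F.step k (by omega) with h' | h'
    · rcases h'.mem_iff.1 h with rfl | h''
      · exact ⟨k, by omega, rfl⟩
      · obtain ⟨j, hj, e⟩ := ih h''
        exact ⟨j, by omega, e⟩
    · obtain ⟨j, hj, e⟩ := ih (h'.le h)
      exact ⟨j, by omega, e⟩

theorem Filtration.simplices_subset (F : Filtration V) :
    {s | ∃ k ≤ F.len, s ∈ F.cx k} ⊆ ((Finset.range F.len).image F.sx : Set (Finset V)) := by
  rintro s ⟨k, hk, h⟩
  obtain ⟨j, hj, e⟩ := F.exists_sx_eq k hk h
  exact Finset.mem_coe.2 (Finset.mem_image.2 ⟨j, Finset.mem_range.2 (by omega), e⟩)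

theorem Filtration.numSimplices_le_len (F : Filtration V) : F.numSimplices ≤ F.len := by
  refine (Set.ncard_le_ncard F.simplices_subset (Finset.finite_toSet _)).trans ?_
  rw [Set.ncard_coe_finset]
  exact Finset.card_image_le.trans (Finset.card_range _).le

theorem Filtration.ncard_faces_le (F : Filtration V) {k : ℕ} (hk : k ≤ F.len) :
    (F.cx k).faces.ncard ≤ F.numSimplices :=
  Set.ncard_le_ncard (fun _ hs => ⟨k, hk, hs⟩)
    ((Finset.finite_toSet _).subset F.simplices_subset)

theorem betti_le {K : Cplx V} (hK : K.faces.Finite) (q : ℕ) :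
    betti K q ≤ (hK.toFinset.filter fun s => s.card = q + 1).card := by
  have h1 := betti_add hK q
  have := finite_chains hK q
  have h2 : Module.finrank (ZMod 2) (cycles K q) ≤ Module.finrank (ZMod 2) (chains K q) :=
    Submodule.finrank_mono inf_le_left
  have h3 : Module.finrank (ZMod 2) (chains K q) =
      (hK.toFinset.filter fun s => s.card = q + 1).card := by
    have hset : {s | s ∈ K ∧ s.card = q + 1} =
        ((hK.toFinset.filter fun s => s.card = q + 1 : Finset (Finset V)) : Set (Finset V)) := by
      ext t
      simp only [Set.mem_ofPred_eq, Finset.coe_filter, Set.Finite.mem_toFinset]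
      rfl
    rw [chains, hset,
      (Finsupp.supportedEquivFinsupp (M := ZMod 2) (R := ZMod 2) _).finrank_eq,
      Module.finrank_finsupp_self]
    exact Fintype.card_coe _
  omega

/-- Each Betti number is at most the number of simplices of that dimension; summing over the
dimensions gives the size of the complex. This is where the time bound gains a factor `n` in place
of the length. -/
theorem IsRepBarcode.countP_contains_le {F : Filtration V} {D : Multiset (Bar V)}
    (h : IsRepBarcode F D) {i : ℕ} (hi : i ≤ F.len) :
    (D.countP fun x => x.Contains i) ≤ (F.cx i).faces.ncard := by
  have hX := isRepBarcode_iff_isRepFamily.1 h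
  have hK := F.finite_faces i hi
  rw [← countP_elt, Set.ncard_eq_toFinset_card _ hK]
  set S := Finset.univ.filter fun j => (elt D j).Contains i with hS
  rw [Finset.card_eq_sum_card_image (fun j => (elt D j).dim) S]
  calc ∑ q ∈ S.image (fun j => (elt D j).dim), (S.filter fun j => (elt D j).dim = q).card
      ≤ ∑ q ∈ S.image (fun j => (elt D j).dim),
          -- Written with `card - 1` so that these sets are the fibres of one function and the sum
          -- over `q` counts each simplex at most once.
          (hK.toFinset.filter fun s => s.card - 1 = q).card := by
        refine Finset.sum_le_sum fun q _ => ?_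
        have h1 : S.filter (fun j => (elt D j).dim = q) = active (elt D) i q := by
          ext j
          rw [hS, Finset.filter_filter, mem_active, Finset.mem_filter]
          exact ⟨fun h => ⟨h.2.2, h.2.1⟩, fun h => ⟨Finset.mem_univ j, h.2, h.1⟩⟩
        rw [h1, hX.card_active i hi q]
        refine (betti_le hK q).trans (Finset.card_le_card ?_)
        intro s hs
        rw [Finset.mem_filter] at hs ⊢
        exact ⟨hs.1, by omega⟩
    _ ≤ hK.toFinset.card := by
        rw [Finset.sum_card_fiberwise_eq_card_filter]
        exact Finset.card_filter_le _ _

/-- Every interval costs one test, but only those satisfying `P`, in practice those through `i`, pay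
the large price `c`. -/
theorem sum_map_one_add_ite_le {α : Type*} (D : Multiset α) (P : α → Prop) [DecidablePred P]
    (f : α → ℕ) {c : ℕ} (hf : ∀ x ∈ D, f x ≤ c) :
    (D.map fun x => 1 + if P x then f x else 0).sum ≤ D.card + D.countP P * c := by
  induction D using Multiset.induction with
  | empty => simp
  | cons a D ih =>
    have ih := ih fun x hx => hf x (Multiset.mem_cons_of_mem hx)
    have ha := hf a (Multiset.mem_cons_self a D)
    rw [Multiset.map_cons, Multiset.sum_cons, Multiset.card_cons, Multiset.countP_cons, add_mul]
    split_ifs <;> omega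

theorem seqSize_le {b d m : ℕ} (h : d < m) : seqSize b d ≤ 3 * m := by
  rw [seqSize]
  omega

/-- Each step shrinks `Λ` by one, so there are at most as many steps as members, each paying for a
search and a sum; the extra `1` is the last, unsuccessful search. -/
theorem Reduces.time_le {F : Filtration V} {n t : ℕ} {U Λ U' Λ' : Multiset (Bar V)}
    (hr : Reduces F n U Λ t U' Λ') {m : ℕ} (hΛ : ∀ x ∈ Λ, x.death < m) :
    t ≤ (Λ.card + 1) * (Λ.card ^ 2 + n * (3 * m)) := by
  induction hr with
  | done U Λ h => exact (Nat.le_add_right _ _).trans (Nat.le_mul_of_pos_left _ (Nat.succ_pos _))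
  | step U Λ x y hxy t U' Λ' hr ih =>
    have ih := ih fun z hz => hΛ z (by
      rcases Multiset.mem_cons.1 hz with rfl | hz
      · simp
      · simp [hz])
    have h1 : sumTime n y.birth y.death ≤ n * (3 * m) :=
      Nat.mul_le_mul_left n (seqSize_le (hΛ y (by simp)))
    simp only [Multiset.card_cons] at ih ⊢
    nlinarith

theorem sum_zipWith_tail_le {α : Type*} (f : α → α → ℕ) {c : ℕ} :
    ∀ L : List α, (∀ x ∈ L, ∀ y ∈ L, f x y ≤ c) →
      (List.zipWith f L L.tail).sum ≤ L.length * c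
  | [], _ => by simp
  | [x], _ => by simp
  | x :: y :: L, h => by
    have ih := sum_zipWith_tail_le f (y :: L) fun a ha b hb => h a (by simp [ha]) b (by simp [hb])
    have h1 := h x (by simp) y (by simp)
    rw [List.tail_cons, List.zipWith_cons_cons, List.sum_cons, List.length_cons, add_mul]
    rw [List.tail_cons] at ih
    omega

theorem sum_map_toList_le {α : Type*} (f : α → ℕ) {c : ℕ} (o : Option α)
    (h : ∀ x ∈ o, f x ≤ c) : (o.toList.map f).sum ≤ c := by
  cases o with
  | none => simp
  | some x => simpa using h x rfl

section

variable {F : Filtration V} {D : Multiset (Bar V)} {i p n m : ℕ}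

theorem carry_death_lt {x : Bar V} (hx : x.death + 2 < m) : (Bar.carry i x).death < m := by
  rw [Bar.carry]
  dsimp only
  split_ifs <;> omega

theorem scanTime_le (hcard : D.card ≤ m) : scanTime n i p D ≤ m + m * n := by
  rw [scanTime]
  refine (sum_map_one_add_ite_le D _ (fun _ => n) fun _ _ => le_rfl).trans ?_
  have h1 := Multiset.countP_le_card (fun x : Bar V => x.dim = p ∧ x.Contains i) D
  gcongr
  exact h1.trans hcard

theorem sum_carryTime_le (hd : ∀ x ∈ D, x.death + 2 < m) (hcard : D.card ≤ m)
    (hn : (D.countP fun x => x.Contains i) ≤ n) :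
    (D.map (carryTime i)).sum ≤ m + n * (3 * m) := by
  refine (sum_map_one_add_ite_le D _ (fun x => seqSize (Bar.carry i x).birth
    (Bar.carry i x).death) fun x hx => seqSize_le (carry_death_lt (hd x hx))).trans ?_
  gcongr

theorem surjTime_le (hd : ∀ x ∈ D, x.death + 2 < m) (hcard : D.card ≤ m)
    (hn : (D.countP fun x => x.Contains i) ≤ n) (hn1 : 1 ≤ n) (hnm : n ≤ m) :
    surjTime n i p D ≤ 100 * (m * n ^ 2) := by
  have h1 := scanTime_le (n := n) (i := i) (p := p) hcard
  have h2 := sum_carryTime_le hd hcard hn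
  rw [surjTime]
  have h3 : n ≤ n ^ 2 := Nat.le_self_pow two_ne_zero n
  have h4 : m * n ≤ m * n ^ 2 := Nat.mul_le_mul_left m h3
  have h5 : m ≤ m * n := Nat.le_mul_of_pos_right m hn1
  nlinarith

theorem injTime_le {F : Filtration V} {t : ℕ} {U₀ Λ₀ U : Multiset (Bar V)} {L : List (Bar V)}
    (hcard : D.card ≤ m) (hΛ : Λ₀.card ≤ n) (hΛd : ∀ x ∈ Λ₀, x.death < m)
    (hr : Reduces F n U₀ Λ₀ t U L)
    (hUd : ∀ x ∈ U, x.death + 2 < m) (hUcard : U.card ≤ m)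
    (hU : (U.countP fun x => x.Contains i) ≤ n) (hL : L.length ≤ n)
    (hLd : ∀ x ∈ L, x.death + 2 < m) (him : i < m) (hn1 : 1 ≤ n) (hnm : n ≤ m) :
    injTime n i p D t U L ≤ 100 * (m * n ^ 2) := by
  have h1 := scanTime_le (n := n) (i := i) (p := p) hcard
  have h2 := sum_carryTime_le hUd hUcard hU
  have h3 : n ≤ n ^ 2 := Nat.le_self_pow two_ne_zero n
  have h4 : m * n ≤ m * n ^ 2 := Nat.mul_le_mul_left m h3
  have h5 : m ≤ m * n := Nat.le_mul_of_pos_right m hn1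
  have h6 : t ≤ 8 * (m * n ^ 2) := by
    refine (hr.time_le hΛd).trans ?_
    -- The bounds `|Λ₀| ≤ n ≤ m` turn the cubic cost of the searches into `m * n ^ 2`.
    calc (Λ₀.card + 1) * (Λ₀.card ^ 2 + n * (3 * m)) ≤ (n + n) * (n * m + n * (3 * m)) := by
          gcongr
          rw [sq]
          exact Nat.mul_le_mul hΛ (hΛ.trans hnm)
      _ = 8 * (m * n ^ 2) := by ring
  have h7 : L.length ^ 2 ≤ m * n ^ 2 := by
    calc L.length ^ 2 ≤ 1 * n ^ 2 := by rw [one_mul]; gcongr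
      _ ≤ m * n ^ 2 := by gcongr; omega
  have h8 := sum_zipWith_tail_le (fun x y : Bar V =>
    sumTime n y.birth x.death + seqSize y.birth (x.death + 2)) (c := n * (3 * m) + 3 * m) L
    fun x hx y _ => add_le_add
      (Nat.mul_le_mul_left n (seqSize_le (by have := hLd x hx; omega))) (seqSize_le (hLd x hx))
  have h9 : L.length * (n * (3 * m) + 3 * m) ≤ 6 * (m * n ^ 2) := by
    calc L.length * (n * (3 * m) + 3 * m) ≤ n * (n * (3 * m) + 3 * m) := by gcongr
      _ = 3 * (m * n ^ 2) + 3 * (m * n) := by ring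
      _ ≤ 6 * (m * n ^ 2) := by omega
  have h10 := sum_map_toList_le (fun x : Bar V => seqSize x.birth i) (c := 3 * m) L.head?
    fun x _ => seqSize_le him
  have h11 := sum_map_toList_le (fun x : Bar V => seqSize (i + 2) (x.death + 2)) (c := 3 * m)
    L.getLast? fun x hx => seqSize_le (hLd x (List.mem_of_mem_getLast? hx))
  have h12 : n * (3 * m) = 3 * (m * n) := by ring
  rw [injTime]
  omega

end

theorem ReductionInvariant.injTime_le {F : Filtration V} {i p t : ℕ} {hi : i ≤ F.len}
    {s : Finset V} {hs : s ∈ F.cx i} {hc : ∀ t ∈ F.cx i, s ⊆ t → t = s}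
    {D U₀ Λ₀ U : Multiset (Bar V)} {L : List (Bar V)} (hD : IsRepBarcode F D)
    (h₀ : ReductionInvariant F i p s U₀ Λ₀) (h : ReductionInvariant F i p s U L)
    (hr : Reduces F (F.expand i hi s hs hc).numSimplices U₀ Λ₀ t U L) :
    injTime (F.expand i hi s hs hc).numSimplices i p D t U L ≤
      100 * ((F.expand i hi s hs hc).len * (F.expand i hi s hs hc).numSimplices ^ 2) := by
  have hfaces : (F.cx i).faces.ncard ≤ (F.expand i hi s hs hc).numSimplices := by
    have := (F.expand i hi s hs hc).ncard_faces_le (k := i)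
      (by rw [Filtration.expand_len]; omega)
    rwa [Filtration.expand_cx_of_le le_rfl] at this
  have hpos : 1 ≤ (F.cx i).faces.ncard :=
    (Set.ncard_pos (F.finite_faces i hi)).2 ⟨s, hs⟩
  have hlen : (F.expand i hi s hs hc).len = F.len + 2 := rfl
  -- All of `Λ` passes through `i`, so `Λ` and the members of `U` through `i` together are bounded
  -- by the size of the complex at `i`, before and after the reduction.
  have hcount : ∀ {U Λ : Multiset (Bar V)}, ReductionInvariant F i p s U Λ →
      (U.countP fun x => x.Contains i) + Λ.card ≤ (F.cx i).faces.ncard := fun {U Λ} h => by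
    have h1 := h.barcode.countP_contains_le hi
    rwa [Multiset.countP_add, (Multiset.countP_eq_card (s := Λ)).2
      fun x hx => (h.touched x hx).2.1] at h1
  have hcard := h.barcode.card_le
  rw [Multiset.card_add] at hcard
  have h1 := hcount h
  rw [Multiset.coe_card] at h1
  refine Zigzag.injTime_le (F := F) (Λ₀ := Λ₀) (hD.card_le.trans (by omega)) ?_ ?_ hr ?_ ?_ ?_ ?_ ?_
    (by omega) (by omega) (Filtration.numSimplices_le_len _)
  · have := hcount h₀
    omega
  · intro x hx
    have := (h₀.barcode.1 x (Multiset.mem_add.2 (Or.inr hx))).death_lt_len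
    omega
  · intro x hx
    have := (h.barcode.1 x (Multiset.mem_add.2 (Or.inl hx))).death_lt_len
    omega
  · omega
  · omega
  · omega
  · intro x hx
    have := (h.barcode.1 x (Multiset.mem_add.2 (Or.inr hx))).death_lt_len
    omega

theorem IsRepBarcode.surjTime_le {F : Filtration V} {i p : ℕ} {hi : i ≤ F.len}
    {s : Finset V} {hs : s ∈ F.cx i} {hc : ∀ t ∈ F.cx i, s ⊆ t → t = s}
    {D : Multiset (Bar V)} (hD : IsRepBarcode F D) :
    surjTime (F.expand i hi s hs hc).numSimplices i p D ≤
      100 * ((F.expand i hi s hs hc).len * (F.expand i hi s hs hc).numSimplices ^ 2) := by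
  have hfaces : (F.cx i).faces.ncard ≤ (F.expand i hi s hs hc).numSimplices := by
    have := (F.expand i hi s hs hc).ncard_faces_le (k := i)
      (by rw [Filtration.expand_len]; omega)
    rwa [Filtration.expand_cx_of_le le_rfl] at this
  have hpos : 1 ≤ (F.cx i).faces.ncard :=
    (Set.ncard_pos (F.finite_faces i hi)).2 ⟨s, hs⟩
  have hlen : (F.expand i hi s hs hc).len = F.len + 2 := rfl
  refine Zigzag.surjTime_le (fun x hx => ?_) (hD.card_le.trans (by omega))
    ((hD.countP_contains_le hi).trans hfaces) (by omega) (Filtration.numSimplices_le_len _)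
  have := (hD.1 x hx).death_lt_len
  omega

end Zigzag

end

/-! ### The theorem assembled -/

theorem mainTheorem2 :
    ∃ C : ℕ, ∀ (V : Type u) (F : Zigzag.Filtration V) (i : ℕ) (hi : i ≤ F.len)
      (p : ℕ) (s : Finset V) (_hp : s.card = p + 1) (hs : s ∈ F.cx i)
      (hc : ∀ t ∈ F.cx i, s ⊆ t → t = s)
      (D : Multiset (Zigzag.Bar V)) (_hD : Zigzag.IsRepBarcode F D),
      let F' := F.expand i hi s hs hc
      let m := F'.len
      let n := F'.numSimplices
      let H := fun q => Zigzag.homologyMap (Zigzag.removeSimplex_le (F.cx i) s hc) q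
      let U₀ := Zigzag.untouched i p s D
      let Λ₀ := Zigzag.touched i p s D
      -- the test that decides between the two cases
      ((∀ q, Function.Surjective (H q)) ↔ Λ₀ = 0) ∧
      ((∀ q, Function.Injective (H q)) ↔ Λ₀ ≠ 0) ∧
      -- the surjective case
      ((∀ q, Function.Surjective (H q)) →
        1 ≤ p ∧
        Zigzag.IsRepBarcode F' (Zigzag.surjOutput i p s D) ∧
        Zigzag.surjTime n i p D ≤ C * (m * n ^ 2)) ∧
      -- the injective case: the procedure can be completed, and every run of it is correct
      ((∀ q, Function.Injective (H q)) →
        (∃ t U Λ, Zigzag.Reduces F n U₀ Λ₀ t U Λ) ∧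
        ∀ t U Λ, Zigzag.Reduces F n U₀ Λ₀ t U Λ →
          (∃ L : List (Zigzag.Bar V), (L : Multiset (Zigzag.Bar V)) = Λ ∧
            L.Pairwise (fun x y => F.precB x.birth y.birth)) ∧
          ∀ L : List (Zigzag.Bar V), (L : Multiset (Zigzag.Bar V)) = Λ →
            L.Pairwise (fun x y => F.precB x.birth y.birth) →
            L ≠ [] ∧
            L.Pairwise (fun x y => F.precD y.death x.death) ∧
            Zigzag.IsRepBarcode F' (Zigzag.injOutput F i U L) ∧
            Zigzag.injTime n i p D t U L ≤ C * (m * n ^ 2)) := by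
  -- A generous constant: in the injective case the separate bounds add up to `27 * (m * n ^ 2)`.
  refine ⟨100, ?_⟩
  intro V F i hi p s hp hs hc D hD F' m n H U₀ Λ₀
  have ha := Zigzag.isAddition_removeSimplex (F.cx i) s hc hs
  have ht : Λ₀ ≠ 0 ↔ Zigzag.IsAddition.Creates (F.cx i) s :=
    Zigzag.touched_ne_zero_iff hD hi hp hc
  have hsurj : (∀ q, Function.Surjective (H q)) ↔ ¬ Zigzag.IsAddition.Creates (F.cx i) s :=
    ha.surjective_iff_not_creates
  have hinj : (∀ q, Function.Injective (H q)) ↔ Zigzag.IsAddition.Creates (F.cx i) s :=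
    ha.injective_iff_creates
  refine ⟨?_, hinj.trans ht.symm, fun h => ?_, fun h => ⟨Zigzag.exists_reduces F n U₀ Λ₀, ?_⟩⟩
  · rw [hsurj, ← ht, not_not]
  · have hcr := hsurj.1 h
    have hp1 : 1 ≤ p := by
      have := ha.two_le_card_of_not_creates hcr
      omega
    exact ⟨hp1, Zigzag.isRepBarcode_surjOutput hD hp hp1 hcr (not_not.1 (mt ht.1 hcr)),
      hD.surjTime_le⟩
  · intro t U Λ hr
    have hcr := hinj.1 h
    have h₀ := Zigzag.ReductionInvariant.init hD (ht.2 hcr)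
    obtain ⟨h₁, hprec⟩ := h₀.reduces hr
    have hb := h₁.barcode.nodup_birth
    have hd := h₁.barcode.nodup_death
    -- Births and deaths are distinct over the whole barcode, hence among the members left in `Λ`;
    -- this makes both orders total there.
    rw [Multiset.map_add] at hb hd
    refine ⟨Zigzag.exists_sorted ((Multiset.nodup_add.1 hb).2.1), ?_⟩
    rintro L rfl hL
    have hne : L ≠ [] := fun h => h₁.ne_zero (by rw [h, Multiset.coe_nil])
    have hdL := Zigzag.pairwise_precD (Multiset.coe_nodup.1 ((Multiset.nodup_add.1 hd).2.1))
      hprec hL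
    exact ⟨hne, hdL, Zigzag.isRepBarcode_injOutput h₁.barcode hp hcr h₁.untouched h₁.touched hne
      hL hdL, h₀.injTime_le hD h₁ hr⟩
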